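/- Theorem. Logarithms are to base $2$. A unary UFA is a finite automaton $(Q,Q_0,\delta,F)$ over a one-letter alphabet, with a set $Q_0\subseteq Q$ of initial states, $\delta\colon Q\to 2^Q$ and a set $F\subseteq Q$ of accepting states, which has exactly one accepting run on every word of the language it accepts and no accepting run on any other word. There are constants $C$ and $K$ and a single random access machine (unit-cost instructions; the only arithmetic is addition and truncated subtraction of natural numbers; automata are given by their number of states, their transition matrix and the characteristic functions of their initial and accepting states) such that for every $n\ge 2$ and every unary UFA $A$ with at most $n$ states, the machine on input $A$ halts after at most $n^{K\log n}$ steps and outputs a UFA with at most $n^{\log n+C}$ states that accepts exactly the words not accepted by $A$. That is, every unary UFA with up to $n$ states has a complement UFA with $n^{\log n+O(1)}$ states, and it can be computed in quasipolynomial time $n^{O(\log n)}$. -/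

import Mathlib

/-- A run of the automaton `M` on the word `w = a₁ ⋯ aₗ`: a sequence `q₀, …, qₗ` of states with
`q₀` initial and `qᵢ₊₁ ∈ δ(qᵢ, aᵢ₊₁)`. It is accepting if its last state is accepting. -/
def NFA.IsAcceptingRun {α σ : Type*} (M : NFA α σ) (w : List α)
    (r : Fin (w.length + 1) → σ) : Prop :=
  r 0 ∈ M.start ∧ (∀ i : Fin w.length, r i.succ ∈ M.step (r i.castSucc) (w.get i)) ∧
    r (Fin.last w.length) ∈ M.accept

/-- Unambiguous automaton: exactly one accepting run for each word of the language, and no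
accepting run for each word outside of it. -/
def NFA.IsUnambiguous {α σ : Type*} (M : NFA α σ) : Prop :=
  (∀ w ∈ M.accepts, ∃! r, M.IsAcceptingRun w r) ∧
    ∀ w ∉ M.accepts, ∀ r, ¬ M.IsAcceptingRun w r

namespace RAM

/-- The memory of a random access machine: registers `x₀, x₁, …` and arrays `A₀, A₁, …`, all with
values in `ℕ`. A program mentions only finitely many registers and arrays. -/
@[ext] structure Memory where
  reg : ℕ → ℕ
  arr : ℕ → ℕ → ℕ

/-- The memory after `xᵢ := v`. -/
def Memory.setReg (s : Memory) (i v : ℕ) : Memory :=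
  { s with reg := Function.update s.reg i v }

/-- The memory after `Aₐ[j] := v`. -/
def Memory.setArr (s : Memory) (a j v : ℕ) : Memory :=
  { s with arr := Function.update s.arr a (Function.update (s.arr a) j v) }

/-- Structured programs of the random access machine. The only arithmetic is addition and
truncated subtraction, so that `t` unit-cost steps produce numbers with at most `O(t)` bits more
than the input and the model is polynomially equivalent to Turing machines. -/
inductive Program where
  /-- do nothing -/
  | skip
  /-- `xᵢ := c` -/
  | const (i c : ℕ)
  /-- `xᵢ := xⱼ + xₖ` -/
  | add (i j k : ℕ)
  /-- `xᵢ := max (xⱼ - xₖ) 0` -/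
  | sub (i j k : ℕ)
  /-- `xᵢ := Aₐ[xⱼ]` -/
  | load (i a j : ℕ)
  /-- `Aₐ[xᵢ] := xⱼ` -/
  | store (a i j : ℕ)
  /-- `p` followed by `q` -/
  | seq (p q : Program)
  /-- if `xᵢ ≠ 0` then `p` else `q` -/
  | ite (i : ℕ) (p q : Program)
  /-- while `xᵢ ≠ 0` do `p` -/
  | loop (i : ℕ) (p : Program)

/-- `Exec p s t s'`: the program `p`, started in the memory `s`, halts after exactly `t` steps in
the memory `s'`. Every elementary instruction and every test counts as one step. -/
inductive Exec : Program → Memory → ℕ → Memory → Prop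
  | skip (s : Memory) : Exec .skip s 1 s
  | const (s : Memory) (i c : ℕ) : Exec (.const i c) s 1 (s.setReg i c)
  | add (s : Memory) (i j k : ℕ) : Exec (.add i j k) s 1 (s.setReg i (s.reg j + s.reg k))
  | sub (s : Memory) (i j k : ℕ) : Exec (.sub i j k) s 1 (s.setReg i (s.reg j - s.reg k))
  | load (s : Memory) (i a j : ℕ) : Exec (.load i a j) s 1 (s.setReg i (s.arr a (s.reg j)))
  | store (s : Memory) (a i j : ℕ) : Exec (.store a i j) s 1 (s.setArr a (s.reg i) (s.reg j))
  | seq {p q : Program} {s s' s'' : Memory} {t u : ℕ} :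
      Exec p s t s' → Exec q s' u s'' → Exec (.seq p q) s (t + u) s''
  | ite_true {i : ℕ} {p q : Program} {s s' : Memory} {t : ℕ} :
      s.reg i ≠ 0 → Exec p s t s' → Exec (.ite i p q) s (t + 1) s'
  | ite_false {i : ℕ} {p q : Program} {s s' : Memory} {t : ℕ} :
      s.reg i = 0 → Exec q s t s' → Exec (.ite i p q) s (t + 1) s'
  | loop_done {i : ℕ} {p : Program} {s : Memory} :
      s.reg i = 0 → Exec (.loop i p) s 1 s
  | loop_step {i : ℕ} {p : Program} {s s' s'' : Memory} {t u : ℕ} :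
      s.reg i ≠ 0 → Exec p s t s' → Exec (.loop i p) s' u s'' →
      Exec (.loop i p) s (t + u + 1) s''

open Classical in
/-- The memory `s` holds a description of the unary automaton `M` with states `0, …, m - 1`:
register `x₀` is `m`, the array `A₀` holds the `0`-`1` transition matrix row by row, and the arrays
`A₁` and `A₂` hold the characteristic functions of the initial and of the accepting states. The
remaining registers and array cells are unconstrained. -/
def Holds (s : Memory) {m : ℕ} (M : NFA Unit (Fin m)) : Prop :=
  s.reg 0 = m ∧
    (∀ i j : Fin m, s.arr 0 (i * m + j) = if j ∈ M.step i () then 1 else 0) ∧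
    (∀ i : Fin m, s.arr 1 i = if i ∈ M.start then 1 else 0) ∧
    ∀ i : Fin m, s.arr 2 i = if i ∈ M.accept then 1 else 0

/-- The memory `s` is the input memory for `M`: it holds the description of `M`, and every register
and array cell outside of this description is `0`. -/
def IsInput (s : Memory) {m : ℕ} (M : NFA Unit (Fin m)) : Prop :=
  Holds s M ∧ (∀ i, i ≠ 0 → s.reg i = 0) ∧
    (∀ c, m * m ≤ c → s.arr 0 c = 0) ∧
    (∀ c, m ≤ c → s.arr 1 c = 0) ∧ (∀ c, m ≤ c → s.arr 2 c = 0) ∧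
    ∀ a c, 2 < a → s.arr a c = 0

end RAM

/-! Let `m` be the number of states. An accepting path on a long word contains closed paths, and
unambiguity forbids trading `p` rounds of a closed path of length `v` against `v` rounds of an
earlier one of length `p`, since this gives a second path of the same total length. Hence for
lengths `x ≥ 2m` the state visited at time `m` lies on a closed path, and the shortest length `p ≤
m` of one through it is the period of `x`. From `2m` on, the set `S p` of lengths of period `p` is a
union of residue classes modulo `p`, and the sets `S p` are disjoint and cover all accepted lengths
(`Unamb.exists_S`, `Unamb.S_add_iff`, `Unamb.S_unique`).

The rejected lengths are found by refining residue classes. Starting from modulus `P = 1`, as long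
as the class of `x` modulo `P` meets some `S p` but lies in none that divides into it, `P` is
replaced by the lcm of `P` and such a `p`. If the class meets both `S p` and `S p'`, the Chinese
remainder theorem would give a common element unless `p` and `p'` share a factor that `P` does not
yet contain (`Unamb.gcd_ne`). So a refinement by `p` either puts the class inside `S p` or at least
halves `p' / gcd p' P` for every remaining `p'`. The factors gained are thus at most `m`, `m / 2`,
`m / 4`, …, the final modulus is at most `halvingProd m ≤ n ^ ((log n + 1) / 2)`, and each final
class lies in one `S p` or avoids all of them (`Unamb.path_invariant`). The classes of the second
kind, the leaves, partition the long rejected lengths.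

The complement automaton has a stem of `W` states, on which short lengths are treated one by one,
followed by a guess of one of the cycles of length `a < W`. Acceptance on a cycle means being in a
leaf of modulus `a`, so the length determines the right guess. This gives `X = W ^ 2` states and the
exponent `log n + 5`.

For the running time, all predicates involved use quantifiers over numbers below `X` and recursions
that are tabulated row by row. Sums over `v < X` yield bounded quantifiers, multiplication and
search in time polynomial in `X`, which is `n ^ O(log n)`. -/

namespace RAM

/-! ### Polynomially bounded running times -/

/-- Functions bounded by a polynomial. -/
def Poly (τ : ℕ → ℕ) : Prop := ∃ c e, ∀ x, τ x ≤ c * (x + 1) ^ e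

theorem Poly.const (c : ℕ) : Poly fun _ => c := ⟨c, 0, fun x => by simp⟩

theorem Poly.id : Poly fun x => x := ⟨1, 1, fun x => by simp⟩

theorem Poly.add {σ τ : ℕ → ℕ} (hσ : Poly σ) (hτ : Poly τ) : Poly fun x => σ x + τ x := by
  obtain ⟨c, e, h⟩ := hσ
  obtain ⟨c', e', h'⟩ := hτ
  refine ⟨c + c', e + e', fun x => ?_⟩
  have h1 : (x + 1) ^ e ≤ (x + 1) ^ (e + e') := Nat.pow_le_pow_right (by omega) (by omega)
  have h2 : (x + 1) ^ e' ≤ (x + 1) ^ (e + e') := Nat.pow_le_pow_right (by omega) (by omega)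
  calc σ x + τ x ≤ c * (x + 1) ^ e + c' * (x + 1) ^ e' := add_le_add (h x) (h' x)
    _ ≤ c * (x + 1) ^ (e + e') + c' * (x + 1) ^ (e + e') := by gcongr
    _ = _ := by ring

theorem Poly.mul {σ τ : ℕ → ℕ} (hσ : Poly σ) (hτ : Poly τ) : Poly fun x => σ x * τ x := by
  obtain ⟨c, e, h⟩ := hσ
  obtain ⟨c', e', h'⟩ := hτ
  refine ⟨c * c', e + e', fun x => ?_⟩
  calc σ x * τ x ≤ (c * (x + 1) ^ e) * (c' * (x + 1) ^ e') := Nat.mul_le_mul (h x) (h' x)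
    _ = _ := by ring

/-! ### Memory updates and loops -/

@[simp] theorem Memory.setReg_reg (s : Memory) (i v j : ℕ) :
    (s.setReg i v).reg j = if j = i then v else s.reg j := by
  simp [Memory.setReg, Function.update_apply]

@[simp] theorem Memory.setReg_arr (s : Memory) (i v : ℕ) : (s.setReg i v).arr = s.arr := rfl

@[simp] theorem Memory.setArr_reg (s : Memory) (a j v : ℕ) : (s.setArr a j v).reg = s.reg := rfl

theorem Memory.setArr_arr (s : Memory) (a j v b c : ℕ) :
    (s.setArr a j v).arr b c = if b = a ∧ c = j then v else s.arr b c := by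
  by_cases hb : b = a
  · subst hb
    simp [Memory.setArr, Function.update_apply]
  · simp [Memory.setArr, hb]

/-- The invariant is indexed by the number of completed rounds, so the loop makes exactly `n`
rounds; each costs one test more than its body, and the last test costs one step. -/
theorem exec_loop {c : ℕ} {body : Program} (Inv : ℕ → Memory → Prop) (n τ : ℕ)
    (step : ∀ i < n, ∀ s, Inv i s →
      s.reg c ≠ 0 ∧ ∃ t s', Exec body s t s' ∧ Inv (i + 1) s' ∧ t ≤ τ)
    (halt : ∀ s, Inv n s → s.reg c = 0) (s : Memory) (h0 : Inv 0 s) :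
    ∃ t s', Exec (.loop c body) s t s' ∧ Inv n s' ∧ t ≤ n * (τ + 1) + 1 := by
  suffices H : ∀ k i, i + k = n → ∀ s, Inv i s →
      ∃ t s', Exec (.loop c body) s t s' ∧ Inv n s' ∧ t ≤ k * (τ + 1) + 1 from
    H n 0 (by omega) s h0
  intro k
  induction k with
  | zero =>
    intro i hi s hs
    obtain rfl : i = n := by omega
    exact ⟨1, s, .loop_done (halt s hs), hs, by omega⟩
  | succ k ih =>
    intro i hi s hs
    obtain ⟨hc, t, s', he, hs', ht⟩ := step i (by omega) s hs
    obtain ⟨u, s'', he', hs'', hu⟩ := ih (i + 1) (by omega) s' hs'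
    refine ⟨t + u + 1, s'', .loop_step hc he he', hs'', ?_⟩
    rw [add_mul]
    omega

/-! ### Computable expressions -/

/-- A description of the memory by a parameter of type `γ`: `E g r A` says that registers `r` and
arrays `A` represent `g`. Register `1` bounds all loops, and registers from `4` on are free. -/
structure Base (γ : Type) where
  X : γ → ℕ
  E : γ → (ℕ → ℕ) → (ℕ → ℕ → ℕ) → Prop
  bound : ∀ g r A, E g r A → r 1 = X g
  stable : ∀ g r r' A, E g r A → (∀ i < 4, r' i = r i) → E g r' A

/-- The parameters which some memory represents. -/
def Base.Valid {γ : Type} (B : Base γ) (g : γ) : Prop := ∃ r A, B.E g r A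

/-- The restriction of a description to parameters with a property. -/
def Base.restrict {γ : Type} (B : Base γ) (c : γ → Prop) : Base γ where
  X := B.X
  E g r A := B.E g r A ∧ c g
  bound g r A h := B.bound g r A h.1
  stable g r r' A h h' := ⟨B.stable g r r' A h.1 h', h.2⟩

/-- Tuples of local variables, kept in the registers from `4` on. -/
class Locals (α : Type) where
  size : ℕ
  Holds : α → (ℕ → ℕ) → Prop
  Bdd : α → ℕ → Prop
  stable : ∀ a r r', Holds a r → (∀ i < 4 + size, r' i = r i) → Holds a r'

instance : Locals Unit where
  size := 0
  Holds _ _ := True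
  Bdd _ _ := True
  stable _ _ _ _ _ := trivial

instance {α : Type} [Locals α] : Locals (α × ℕ) where
  size := Locals.size α + 1
  Holds q r := Locals.Holds q.1 r ∧ r (4 + Locals.size α) = q.2
  Bdd q X := Locals.Bdd q.1 X ∧ q.2 < X
  stable q r r' h h' :=
    ⟨Locals.stable q.1 r r' h.1 fun i hi => h' i (by omega), (h' _ (by omega)).trans h.2⟩

/-- `f` can be computed into any free register, in polynomial time. -/
def Comp {γ α : Type} [Locals α] (B : Base γ) (f : γ → α → ℕ) : Prop :=
  ∀ d, 4 + Locals.size α ≤ d → ∃ p τ, Poly τ ∧ ∀ g q s,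
    B.E g s.reg s.arr → Locals.Holds q s.reg → Locals.Bdd q (B.X g) →
    ∃ t s', Exec p s t s' ∧ s'.reg d = f g q ∧ (∀ i < d, s'.reg i = s.reg i) ∧
      s'.arr = s.arr ∧ t ≤ τ (B.X g)

/-- The value `1` for true and `0` for false. -/
noncomputable def ind (p : Prop) : ℕ := @ite _ p (Classical.propDecidable p) 1 0

theorem ind_true {p : Prop} (h : p) : ind p = 1 := if_pos h

theorem ind_false {p : Prop} (h : ¬p) : ind p = 0 := if_neg h

theorem ind_pos {p : Prop} : 0 < ind p ↔ p := by
  by_cases h : p <;> simp [ind, h]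

theorem ind_congr {p q : Prop} (h : p ↔ q) : ind p = ind q := by rw [propext h]

/-- The predicate `p` can be decided in polynomial time. -/
def CompP {γ α : Type} [Locals α] (B : Base γ) (p : γ → α → Prop) : Prop :=
  Comp B fun g q => ind (p g q)

section Expressions

variable {γ α : Type} [Locals α] {B : Base γ} {f h : γ → α → ℕ} {p p' : γ → α → Prop}

theorem Base.frame {g : γ} {q : α} {s s' : Memory} {d : ℕ} (hE : B.E g s.reg s.arr)
    (hL : Locals.Holds q s.reg) (hd : 4 + Locals.size α ≤ d)
    (hr : ∀ i < d, s'.reg i = s.reg i) (hA : s'.arr = s.arr) :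
    B.E g s'.reg s'.arr ∧ Locals.Holds q s'.reg :=
  ⟨hA ▸ B.stable _ _ _ _ hE fun i hi => hr i (by omega),
    Locals.stable _ _ _ hL fun i hi => hr i (by omega)⟩

theorem Comp.congr (hf : Comp B f)
    (hfh : ∀ g q, B.Valid g → Locals.Bdd q (B.X g) → f g q = h g q) : Comp B h := by
  intro d hd
  obtain ⟨p, τ, hτ, H⟩ := hf d hd
  refine ⟨p, τ, hτ, fun g q s hE hL hq => ?_⟩
  rw [← hfh g q ⟨_, _, hE⟩ hq]
  exact H g q s hE hL hq

theorem CompP.congr (hp : CompP B p)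
    (hpp : ∀ g q, B.Valid g → Locals.Bdd q (B.X g) → (p g q ↔ p' g q)) : CompP B p' :=
  Comp.congr hp fun g q hg hq => ind_congr (hpp g q hg hq)

theorem Comp.restrict (hf : Comp B f) (c : γ → Prop) : Comp (B.restrict c) f := by
  intro d hd
  obtain ⟨p, τ, hτ, H⟩ := hf d hd
  exact ⟨p, τ, hτ, fun g q s hE hL hq => H g q s hE.1 hL hq⟩

theorem Comp.const (c : ℕ) : Comp B fun _ (_ : α) => c := fun d _ =>
  ⟨.const d c, _, Poly.const 1, fun g q s hE hL hq =>
    ⟨1, _, .const s d c, by simp, fun i hi => by simp; omega, rfl, le_rfl⟩⟩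

theorem Comp.move (r : ℕ) {f : γ → α → ℕ} (hr : r < 4 + Locals.size α)
    (hf : ∀ g q (s : Memory), B.E g s.reg s.arr → Locals.Holds q s.reg → s.reg r = f g q) :
    Comp B f := fun d hd =>
  ⟨.seq (.const d 0) (.add d r d), _, Poly.const 2, fun g q s hE hL hq =>
    ⟨2, _, .seq (.const s d 0) (.add _ d r d), by
      have : r ≠ d := by omega
      simp [this, hf g q s hE hL], fun i hi => by
      have : i ≠ d := by omega
      simp [this], rfl, le_rfl⟩⟩

theorem Comp.bound : Comp B fun g (_ : α) => B.X g :=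
  Comp.move 1 (by omega) fun g _ s hE _ => B.bound g s.reg s.arr hE

theorem Comp.add (hf : Comp B f) (hh : Comp B h) : Comp B fun g q => f g q + h g q := by
  intro d hd
  obtain ⟨p₁, τ₁, hτ₁, H₁⟩ := hf d hd
  obtain ⟨p₂, τ₂, hτ₂, H₂⟩ := hh (d + 1) (by omega)
  refine ⟨.seq p₁ (.seq p₂ (.add d d (d + 1))), _, hτ₁.add (hτ₂.add (.const 1)), ?_⟩
  intro g q s hE hL hq
  obtain ⟨t₁, s₁, e₁, v₁, r₁, a₁, b₁⟩ := H₁ g q s hE hL hq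
  obtain ⟨hE₁, hL₁⟩ := B.frame hE hL hd r₁ a₁
  obtain ⟨t₂, s₂, e₂, v₂, r₂, a₂, b₂⟩ := H₂ g q s₁ hE₁ hL₁ hq
  refine ⟨_, _, .seq e₁ (.seq e₂ (.add _ _ _ _)), ?_, fun i hi => ?_, a₂.trans a₁, by omega⟩
  · simp [v₂, r₂ d (by omega), v₁]
  · have : i ≠ d := by omega
    simp [this, r₂ i (by omega), r₁ i hi]

theorem Comp.sub (hf : Comp B f) (hh : Comp B h) : Comp B fun g q => f g q - h g q := by
  intro d hd
  obtain ⟨p₁, τ₁, hτ₁, H₁⟩ := hf d hd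
  obtain ⟨p₂, τ₂, hτ₂, H₂⟩ := hh (d + 1) (by omega)
  refine ⟨.seq p₁ (.seq p₂ (.sub d d (d + 1))), _, hτ₁.add (hτ₂.add (.const 1)), ?_⟩
  intro g q s hE hL hq
  obtain ⟨t₁, s₁, e₁, v₁, r₁, a₁, b₁⟩ := H₁ g q s hE hL hq
  obtain ⟨hE₁, hL₁⟩ := B.frame hE hL hd r₁ a₁
  obtain ⟨t₂, s₂, e₂, v₂, r₂, a₂, b₂⟩ := H₂ g q s₁ hE₁ hL₁ hq
  refine ⟨_, _, .seq e₁ (.seq e₂ (.sub _ _ _ _)), ?_, fun i hi => ?_, a₂.trans a₁, by omega⟩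
  · simp [v₂, r₂ d (by omega), v₁]
  · have : i ≠ d := by omega
    simp [this, r₂ i (by omega), r₁ i hi]

theorem Comp.load (b : ℕ) (hf : Comp B f) (hfh : ∀ g q r A, B.E g r A →
    Locals.Bdd q (B.X g) → A b (f g q) = h g q) : Comp B h := by
  intro d hd
  obtain ⟨p₁, τ₁, hτ₁, H₁⟩ := hf d hd
  refine ⟨.seq p₁ (.load d b d), _, hτ₁.add (.const 1), ?_⟩
  intro g q s hE hL hq
  obtain ⟨t₁, s₁, e₁, v₁, r₁, a₁, b₁⟩ := H₁ g q s hE hL hq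
  refine ⟨_, _, .seq e₁ (.load _ _ _ _), ?_, fun i hi => ?_, a₁, by omega⟩
  · simp [v₁, a₁, hfh g q _ _ hE hq]
  · have : i ≠ d := by omega
    simp [this, r₁ i hi]

/-- Each branch has to be correct only on its own side of the test. This allows row `0` of a
recursive table to be computed differently from the rows that read earlier ones. -/
theorem Comp.select_ghost {c : γ → Prop} (hc : CompP B fun g (_ : α) => c g)
    (hf : Comp (B.restrict c) f) (hh : Comp (B.restrict fun g => ¬c g) h)
    {k : γ → α → ℕ} (hk : ∀ g q, c g → k g q = f g q) (hk' : ∀ g q, ¬c g → k g q = h g q) :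
    Comp B k := by
  intro d hd
  obtain ⟨p₀, τ₀, hτ₀, H₀⟩ := hc d hd
  obtain ⟨p₁, τ₁, hτ₁, H₁⟩ := hf d hd
  obtain ⟨p₂, τ₂, hτ₂, H₂⟩ := hh d hd
  refine ⟨.seq p₀ (.ite d p₁ p₂), _, hτ₀.add ((hτ₁.add hτ₂).add (.const 1)), ?_⟩
  intro g q s hE hL hq
  obtain ⟨t₀, s₀, e₀, v₀, r₀, a₀, b₀⟩ := H₀ g q s hE hL hq
  obtain ⟨hE₀, hL₀⟩ := B.frame hE hL hd r₀ a₀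
  by_cases hg : c g
  · obtain ⟨t₁, s₁, e₁, v₁, r₁, a₁, b₁⟩ := H₁ g q s₀ ⟨hE₀, hg⟩ hL₀ hq
    refine ⟨_, _, .seq e₀ (.ite_true ?_ e₁), by rw [v₁, hk g q hg],
      fun i hi => by rw [r₁ i hi, r₀ i hi], a₁.trans a₀, ?_⟩
    · simp [v₀, ind_true hg]
    · simp only [Base.restrict] at b₁
      omega
  · obtain ⟨t₁, s₁, e₁, v₁, r₁, a₁, b₁⟩ := H₂ g q s₀ ⟨hE₀, hg⟩ hL₀ hq
    refine ⟨_, _, .seq e₀ (.ite_false ?_ e₁), by rw [v₁, hk' g q hg],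
      fun i hi => by rw [r₁ i hi, r₀ i hi], a₁.trans a₀, ?_⟩
    · simp [v₀, ind_false hg]
    · simp only [Base.restrict] at b₁
      omega

theorem Comp.gate (hp : CompP B p) (hf : Comp B f) : Comp B fun g q => ind (p g q) * f g q := by
  intro d hd
  obtain ⟨p₀, τ₀, hτ₀, H₀⟩ := hp d hd
  obtain ⟨p₁, τ₁, hτ₁, H₁⟩ := hf d hd
  refine ⟨.seq p₀ (.ite d p₁ .skip), _, hτ₀.add (hτ₁.add (.const 2)), ?_⟩
  intro g q s hE hL hq
  obtain ⟨t₀, s₀, e₀, v₀, r₀, a₀, b₀⟩ := H₀ g q s hE hL hq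
  obtain ⟨hE₀, hL₀⟩ := B.frame hE hL hd r₀ a₀
  by_cases hg : p g q
  · obtain ⟨t₁, s₁, e₁, v₁, r₁, a₁, b₁⟩ := H₁ g q s₀ hE₀ hL₀ hq
    refine ⟨_, _, .seq e₀ (.ite_true ?_ e₁), by simp [v₁, ind_true hg],
      fun i hi => by rw [r₁ i hi, r₀ i hi], a₁.trans a₀, by omega⟩
    simp [v₀, ind_true hg]
  · refine ⟨_, _, .seq e₀ (.ite_false ?_ (.skip _)), by simp [v₀, ind_false hg],
      fun i hi => r₀ i hi, a₀, by omega⟩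
    simp [v₀, ind_false hg]

/-- The only loop inside expressions; quantifiers, products and searches are all reduced to it. The
bound variable occupies register `k`, the first one after the locals, which may lie below `d` and
must then be preserved: its content is saved in `d + 1` and restored at the end. Register `d + 2`
accumulates, `d + 3` counts the remaining rounds, and `d + 4` holds `1` during the loop. -/
theorem Comp.sum {f : γ → α → ℕ → ℕ} (hf : Comp B fun g (q : α × ℕ) => f g q.1 q.2) :
    Comp B fun g q => ∑ v ∈ Finset.range (B.X g), f g q v := by
  intro d hd
  set k := 4 + Locals.size α with hk
  have hsz : Locals.size (α × ℕ) = Locals.size α + 1 := rfl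
  obtain ⟨p, τ, hτ, H⟩ := hf (d + 5) (by omega)
  refine ⟨.seq (.const (d + 4) 0) (.seq (.add (d + 1) k (d + 4)) (.seq (.const k 0)
    (.seq (.const (d + 2) 0) (.seq (.const (d + 4) 1) (.seq (.sub (d + 3) 1 k)
    (.seq (.loop (d + 3) (.seq p (.seq (.add (d + 2) (d + 2) (d + 5)) (.seq (.add k k (d + 4))
      (.sub (d + 3) 1 k))))) (.seq (.const (d + 4) 0) (.seq (.add k (d + 1) (d + 4))
      (.add d (d + 2) (d + 4)))))))))), fun x => (x * (τ x + 3 + 1) + 1) + 9,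
      ((Poly.id.mul ((hτ.add (.const 3)).add (.const 1))).add (.const 1)).add (.const 9), ?_⟩
  intro g q s hE hL hq
  let Inv : ℕ → Memory → Prop := fun i u => (∀ j < d, j ≠ k → u.reg j = s.reg j) ∧
    u.arr = s.arr ∧ u.reg k = i ∧ u.reg (d + 1) = s.reg k ∧
    u.reg (d + 2) = ∑ v ∈ Finset.range i, f g q v ∧ u.reg (d + 3) = B.X g - i ∧ u.reg (d + 4) = 1
  have hX : s.reg 1 = B.X g := B.bound _ _ _ hE
  obtain ⟨t, u, hu, ⟨i₁, i₂, i₃, i₄, i₅, i₆, i₇⟩, ht⟩ := exec_loop (c := d + 3)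
    (body := .seq p (.seq (.add (d + 2) (d + 2) (d + 5))
      (.seq (.add k k (d + 4)) (.sub (d + 3) 1 k)))) Inv (B.X g) (τ (B.X g) + 3)
    (by
      rintro i hi u ⟨i₁, i₂, i₃, i₄, i₅, i₆, i₇⟩
      refine ⟨by omega, ?_⟩
      have hEu : B.E g u.reg u.arr := i₂ ▸ B.stable _ _ _ _ hE fun j hj => i₁ j (by omega) (by omega)
      have hLu : Locals.Holds q u.reg :=
        Locals.stable _ _ _ hL fun j hj => i₁ j (by omega) (by omega)
      obtain ⟨t₁, s₁, e₁, v₁, r₁, a₁, b₁⟩ := H g (q, i) u hEu ⟨hLu, i₃⟩ ⟨hq, hi⟩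
      refine ⟨_, _, .seq e₁ (.seq (.add _ _ _ _) (.seq (.add _ _ _ _) (.sub _ _ _ _))),
        ⟨fun j hj hjk => ?_, ?_, ?_, ?_, ?_, ?_, ?_⟩, by omega⟩
      · have h1 : j ≠ d + 3 := by omega
        have h2 : j ≠ d + 2 := by omega
        simp [h1, h2, hjk, r₁ j (by omega), i₁ j hj hjk]
      · simpa using a₁.trans i₂
      · have h1 : k ≠ d + 3 := by omega
        have h2 : k ≠ d + 2 := by omega
        simp [h1, h2, r₁ k (by omega), i₃, r₁ (d + 4) (by omega), i₇]
      · have h1 : d + 1 ≠ k := by omega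
        simp [h1, r₁ (d + 1) (by omega), i₄]
      · have h1 : d + 2 ≠ k := by omega
        simp [h1, r₁ (d + 2) (by omega), i₅, v₁, Finset.sum_range_succ]
      · have h1 : k ≠ d + 2 := by omega
        have h3 : 1 ≠ k := by omega
        simp [h1, h3, r₁ k (by omega), i₃, r₁ (d + 4) (by omega), i₇, r₁ 1 (by omega),
          i₁ 1 (by omega) (by omega), hX]
      · have h1 : d + 4 ≠ k := by omega
        simp [h1, r₁ (d + 4) (by omega), i₇])
    (by
      rintro u ⟨i₁, i₂, i₃, i₄, i₅, i₆, i₇⟩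
      omega)
    ((((((s.setReg (d + 4) 0).setReg (d + 1) (s.reg k)).setReg k 0).setReg (d + 2) 0).setReg
      (d + 4) 1).setReg (d + 3) (B.X g))
    (by
      refine ⟨fun j hj hjk => ?_, rfl, ?_, ?_, ?_, ?_, ?_⟩
      · have h1 : j ≠ d + 3 := by omega
        have h2 : j ≠ d + 2 := by omega
        have h3 : j ≠ d + 4 := by omega
        have h4 : j ≠ d + 1 := by omega
        simp [h1, h2, h3, h4, hjk]
      · have h1 : k ≠ d + 3 := by omega
        have h2 : k ≠ d + 2 := by omega
        have h3 : k ≠ d + 4 := by omega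
        simp [h1, h2, h3]
      · have h1 : d + 1 ≠ k := by omega
        simp [h1]
      · simp
      · simp
      · simp)
  refine ⟨_, _, .seq (.const _ _ _) (.seq (.add _ _ _ _) (.seq (.const _ _ _)
    (.seq (.const _ _ _) (.seq (.const _ _ _) (.seq (.sub _ _ _ _)
    (.seq (by
      convert hu using 2
      · have h1 : k ≠ d + 4 := by omega
        simp [h1]
      · have h3 : k ≠ d + 4 := by omega
        have h4 : k ≠ d + 2 := by omega
        have h5 : 1 ≠ k := by omega
        have h7 : d ≠ 0 := by omega
        simp [h3, h4, h5, h7, hX]) (.seq (.const _ _ _) (.seq (.add _ _ _ _)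
      (.add _ _ _ _))))))))), ?_, fun i hi => ?_, ?_, ?_⟩
  · have h1 : d + 2 ≠ k := by omega
    have h2 : d + 4 ≠ k := by omega
    simp [h1, h2, i₅]
  · by_cases hik : i = k
    · subst hik
      have h1 : k ≠ d := by omega
      simp [h1, i₄]
    · have h1 : i ≠ d := by omega
      have h2 : i ≠ d + 4 := by omega
      simp [hik, h1, h2, i₁ i hi hik]
  · simpa using i₂
  · show _ ≤ (B.X g * (τ (B.X g) + 3 + 1) + 1) + 9
    omega

theorem Comp.var : Comp B fun _ (q : α × ℕ) => q.2 :=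
  Comp.move (4 + Locals.size α) (by show _ < 4 + (Locals.size α + 1); omega)
    fun _ _ _ _ hL => hL.2

theorem Comp.weak (hf : Comp B f) : Comp B fun g (q : α × ℕ) => f g q.1 := by
  intro d hd
  have hsz : Locals.size (α × ℕ) = Locals.size α + 1 := rfl
  obtain ⟨p, τ, hτ, H⟩ := hf d (by omega)
  exact ⟨p, τ, hτ, fun g q s hE hL hq => H g q.1 s hE hL.1 hq.1⟩

theorem CompP.not (hp : CompP B p) : CompP B fun g q => ¬p g q :=
  Comp.congr ((Comp.const 1).sub hp) fun g q _ _ => by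
    by_cases h : p g q <;> simp [ind, h]

theorem CompP.and (hp : CompP B p) (hp' : CompP B p') : CompP B fun g q => p g q ∧ p' g q :=
  Comp.congr ((Comp.add hp hp').sub (Comp.const 1)) fun g q _ _ => by
    by_cases h : p g q <;> by_cases h' : p' g q <;> simp [ind, h, h']

theorem CompP.or (hp : CompP B p) (hp' : CompP B p') : CompP B fun g q => p g q ∨ p' g q :=
  (hp.not.and hp'.not).not.congr fun g q _ _ => by tauto

theorem CompP.imp (hp : CompP B p) (hp' : CompP B p') : CompP B fun g q => p g q → p' g q :=
  (hp.not.or hp').congr fun g q _ _ => by tauto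

theorem CompP.lt (hf : Comp B f) (hh : Comp B h) : CompP B fun g q => f g q < h g q :=
  Comp.congr ((Comp.const 1).sub ((Comp.const 1).sub (hh.sub hf))) fun g q _ _ => by
    by_cases hlt : f g q < h g q <;> simp [ind, hlt] <;> omega

theorem CompP.le (hf : Comp B f) (hh : Comp B h) : CompP B fun g q => f g q ≤ h g q :=
  (CompP.lt hh hf).not.congr fun g q _ _ => by omega

theorem CompP.eq (hf : Comp B f) (hh : Comp B h) : CompP B fun g q => f g q = h g q :=
  ((CompP.le hf hh).and (CompP.le hh hf)).congr fun g q _ _ => by omega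

theorem CompP.ne_zero (hf : Comp B f) : CompP B fun g q => f g q ≠ 0 :=
  (CompP.eq hf (.const 0)).not

theorem CompP.ex {p : γ → α → ℕ → Prop} (hp : CompP B fun g (q : α × ℕ) => p g q.1 q.2) :
    CompP B fun g q => ∃ v < B.X g, p g q v :=
  (CompP.lt (.const 0) (Comp.sum (f := fun g q v => ind (p g q v)) hp)).congr fun g q _ _ => by
    rw [Finset.sum_pos_iff]
    simp [ind_pos]

theorem CompP.all {p : γ → α → ℕ → Prop} (hp : CompP B fun g (q : α × ℕ) => p g q.1 q.2) :
    CompP B fun g q => ∀ v < B.X g, p g q v :=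
  (CompP.ex (p := fun g q v => ¬p g q v) hp.not).not.congr fun g q _ _ => by push Not; rfl

/-- The product is the sum of `f` copies of `h`, padded by zeros to `X` terms; hence only the first
factor has to be bounded by `X`. -/
theorem Comp.mul (hf : Comp B f) (hh : Comp B h)
    (hX : ∀ g q, B.Valid g → Locals.Bdd q (B.X g) → f g q ≤ B.X g) :
    Comp B fun g q => f g q * h g q :=
  (Comp.sum (f := fun g q v => ind (v < f g q) * h g q)
    (Comp.gate (CompP.lt Comp.var hf.weak) hh.weak)).congr fun g q hg hq => by
    have := hX g q hg hq
    have h2 : ∀ v, ind (v < f g q) = if v < f g q then 1 else 0 := fun v => by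
      by_cases hv : v < f g q <;> simp [ind, hv]
    rw [← Finset.sum_mul]
    congr 1
    simp only [h2, Finset.sum_boole, Nat.cast_id]
    rw [show (Finset.range (B.X g)).filter (fun v => v < f g q) = Finset.range (f g q) by
      ext; simp; omega, Finset.card_range]

/-- The least `v < X` with `φ v`, or `X` if there is none. -/
noncomputable def least (X : ℕ) (φ : ℕ → Prop) : ℕ :=
  -- The least witness is the number of `v` up to which no witness has occurred, so a search is a
  -- bounded sum without early exit.
  ∑ v ∈ Finset.range X, ind (∀ u < X, u ≤ v → ¬φ u)

theorem least_eq {X v : ℕ} {φ : ℕ → Prop} (hv : v < X) (h : φ v) (hmin : ∀ u < v, ¬φ u) :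
    least X φ = v := by
  have h2 : ∀ w ∈ Finset.range X, ind (∀ u < X, u ≤ w → ¬φ u) = if w < v then 1 else 0 := by
    intro w hw
    split_ifs with hwv
    · exact ind_true fun u _ hu => hmin u (by omega)
    · exact ind_false fun hall => hall v hv (by omega) h
  rw [least, Finset.sum_congr rfl h2, Finset.sum_boole, Nat.cast_id,
    show (Finset.range X).filter (fun w => w < v) = Finset.range v by ext; simp; omega,
    Finset.card_range]

theorem Comp.least {p : γ → α → ℕ → Prop}
    (hp : CompP B fun g (q : (α × ℕ) × ℕ) => p g q.1.1 q.2) :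
    Comp B fun g q => RAM.least (B.X g) (p g q) :=
  Comp.sum (f := fun g q v => ind (∀ u < B.X g, u ≤ v → ¬p g q u))
    (CompP.all (p := fun g (q : α × ℕ) u => u ≤ q.2 → ¬p g q.1 u)
      ((CompP.le Comp.var Comp.var.weak).imp hp.not))

end Expressions

end RAM

namespace RAM

/-! ### Programs between descriptions -/

/-- Some program leads from memories described by `B` to memories described by `B'`, in time
polynomial in `Y`. -/
def Run {γ : Type} (Y : γ → ℕ) (B B' : Base γ) : Prop :=
  ∃ p τ, Poly τ ∧ ∀ g s, B.E g s.reg s.arr →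
    ∃ t s', Exec p s t s' ∧ B'.E g s'.reg s'.arr ∧ t ≤ τ (Y g)

section Programs

variable {γ : Type} {Y : γ → ℕ} {B B' B'' : Base γ}

theorem Run.trans (h : Run Y B B') (h' : Run Y B' B'') : Run Y B B'' := by
  obtain ⟨p, τ, hτ, H⟩ := h
  obtain ⟨p', τ', hτ', H'⟩ := h'
  refine ⟨.seq p p', _, hτ.add hτ', fun g s hE => ?_⟩
  obtain ⟨t, s', e, hE', ht⟩ := H g s hE
  obtain ⟨t', s'', e', hE'', ht'⟩ := H' g s' hE'
  exact ⟨_, _, .seq e e', hE'', add_le_add ht ht'⟩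

theorem Run.of_imp (h : ∀ g r A, B.E g r A → B'.E g r A) : Run Y B B' :=
  ⟨.skip, _, .const 1, fun _ s hE => ⟨1, s, .skip s, h _ _ _ hE, le_rfl⟩⟩

/-- A time bound need not be monotone; this passes from the current loop bound to a larger quantity
`Y`. -/
theorem poly_comp_le {τ : ℕ → ℕ} (hτ : Poly τ) : ∃ σ, Poly σ ∧ ∀ x y, x ≤ y → τ x ≤ σ y := by
  obtain ⟨c, e, h⟩ := hτ
  exact ⟨fun x => c * (x + 1) ^ e, ⟨c, e, fun x => le_rfl⟩, fun x y hxy =>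
    (h x).trans (Nat.mul_le_mul_left c (Nat.pow_le_pow_left (by omega) e))⟩

theorem Run.assign {f : γ → Unit → ℕ} (i : ℕ) (hf : Comp B f) (hY : ∀ g, B.Valid g → B.X g ≤ Y g)
    (h : ∀ g r A, B.E g r A → B'.E g (Function.update r i (f g ())) A) : Run Y B B' := by
  obtain ⟨p, τ, hτ, H⟩ := hf (4 + i + 1) (by simp only [Locals.size]; omega)
  obtain ⟨σ, hσ, hle⟩ := poly_comp_le hτ
  refine ⟨.seq p (.seq (.const (4 + i + 2) 0) (.add i (4 + i + 1) (4 + i + 2))), _,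
    hσ.add (.const 2), fun g s hE => ?_⟩
  obtain ⟨t, s', e, hv, hr, hA, ht⟩ := H g () s hE trivial trivial
  refine ⟨_, _, .seq e (.seq (.const _ _ _) (.add _ _ _ _)), ?_, ?_⟩
  · refine B'.stable _ _ _ _ (by simpa [hA] using h _ _ _ hE) fun j hj => ?_
    by_cases hji : j = i
    · subst hji
      simp [hv]
    · have h1 : j ≠ 4 + i + 2 := by omega
      simp [hji, h1, hr j (by omega)]
  · have := hle _ _ (hY g ⟨_, _, hE⟩)
    omega

/-- The registers `0`, `1`, `2` hold `m`, `X`, `w`, and the arrays satisfy `T`. -/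
def tab (m X w : γ → ℕ) (T : γ → (ℕ → ℕ → ℕ) → Prop) : Base γ where
  X := X
  E g r A := r 0 = m g ∧ r 1 = X g ∧ r 2 = w g ∧ T g A
  bound _ _ _ h := h.2.1
  stable g r r' A h h' := by
    rwa [h' 0 (by omega), h' 1 (by omega), h' 2 (by omega)]

/-- The rows below `n` of the table `G` are stored in `a`. -/
def Rows (X n : ℕ) (G : ℕ → ℕ → ℕ) (a : ℕ → ℕ) : Prop :=
  ∀ i < n, ∀ j < X, a (i * X + j) = G i j

/-- While row `i` of the table `G` is being filled: register `3` holds `i`. -/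
def row (m X w : γ → ℕ) (T : γ → (ℕ → ℕ → ℕ) → Prop) (b : ℕ) (G : γ → ℕ → ℕ → ℕ) :
    Base (γ × ℕ) where
  X g := X g.1
  E g r A := r 0 = m g.1 ∧ r 1 = X g.1 ∧ r 2 = w g.1 ∧ T g.1 A ∧ r 3 = g.2 ∧ g.2 < X g.1 ∧
    Rows (X g.1) g.2 (G g.1) (A b)
  bound _ _ _ h := h.2.1
  stable g r r' A h h' := by
    rwa [h' 0 (by omega), h' 1 (by omega), h' 2 (by omega), h' 3 (by omega)]

/-- An entry may be computed from the rows already written, which `row` records; this is how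
recursive definitions are evaluated although expressions have no recursion. -/
theorem Run.fill {m X w : γ → ℕ} {T T' : γ → (ℕ → ℕ → ℕ) → Prop} (b : ℕ) (G : γ → ℕ → ℕ → ℕ)
    (hY : ∀ g, (tab m X w T).Valid g → X g ≤ Y g)
    (hT : ∀ g A A', (∀ a, a ≠ b → A' a = A a) → T g A → T g A')
    (hG : Comp (row m X w T b G) fun g (q : Unit × ℕ) => G g.1 g.2 q.2)
    (hT' : ∀ g A, T g A → Rows (X g) (X g) (G g) (A b) → T' g A) :
    Run Y (tab m X w T) (tab m X w T') := by
  -- Registers `3` and `4` hold row and column, `5` the running address `i * X + j`, `6` and `7` the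
  -- numbers of remaining rows and columns, `8` the constant `1`, and `10` the entry.
  obtain ⟨p, τ, hτ, H⟩ := hG 10 (by simp [Locals.size])
  obtain ⟨σ, hσ, hle⟩ := poly_comp_le
    (τ := fun x => (x * ((2 + ((x * ((τ x + 4) + 1) + 1) + 2)) + 1) + 1) + 4)
    (((Poly.id.mul (((Poly.const 2).add (((Poly.id.mul ((hτ.add (.const 4)).add (.const 1))).add
      (.const 1)).add (.const 2))).add (.const 1))).add (.const 1)).add (.const 4))
  refine ⟨.seq (.const 3 0) (.seq (.const 5 0) (.seq (.const 8 1) (.seq (.sub 6 1 3)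
    (.loop 6 (.seq (.const 4 0) (.seq (.sub 7 1 4) (.seq (.loop 7 (.seq p (.seq (.store b 5 10)
      (.seq (.add 5 5 8) (.seq (.add 4 4 8) (.sub 7 1 4))))))
      (.seq (.add 3 3 8) (.sub 6 1 3))))))))), _, hσ, fun g s hE => ?_⟩
  obtain ⟨h0, h1, h2, hTA⟩ := hE
  let Com : Memory → Prop := fun u => u.reg 0 = m g ∧ u.reg 1 = X g ∧ u.reg 2 = w g ∧ T g u.arr ∧
    u.reg 8 = 1
  let Inv : ℕ → Memory → Prop := fun i u => Com u ∧ u.reg 3 = i ∧ u.reg 5 = i * X g ∧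
    u.reg 6 = X g - i ∧ Rows (X g) i (G g) (u.arr b)
  let Inv' : ℕ → ℕ → Memory → Prop := fun i j u => Com u ∧ u.reg 3 = i ∧ u.reg 4 = j ∧
    u.reg 5 = i * X g + j ∧ u.reg 7 = X g - j ∧ Rows (X g) i (G g) (u.arr b) ∧
    ∀ j' < j, u.arr b (i * X g + j') = G g i j'
  obtain ⟨t, u, hu, ⟨⟨c₀, c₁, c₂, c₃, c₄⟩, i₁, i₂, i₃, i₄⟩, ht⟩ := exec_loop (c := 6) (body :=
    .seq (.const 4 0) (.seq (.sub 7 1 4) (.seq (.loop 7 (.seq p (.seq (.store b 5 10)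
      (.seq (.add 5 5 8) (.seq (.add 4 4 8) (.sub 7 1 4))))))
      (.seq (.add 3 3 8) (.sub 6 1 3))))) Inv (X g)
    (2 + ((X g * ((τ (X g) + 4) + 1) + 1) + 2))
    (by
      rintro i hi u ⟨⟨c₀, c₁, c₂, c₃, c₄⟩, i₁, i₂, i₃, i₄⟩
      refine ⟨by omega, ?_⟩
      obtain ⟨t, u', hu, ⟨⟨d₀, d₁, d₂, d₃, d₄⟩, j₁, j₂, j₃, j₄, j₅, j₆⟩, ht⟩ :=
        exec_loop (c := 7) (body := .seq p (.seq (.store b 5 10)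
        (.seq (.add 5 5 8) (.seq (.add 4 4 8) (.sub 7 1 4))))) (Inv' i) (X g) (τ (X g) + 4)
        (by
          rintro j hj v ⟨⟨d₀, d₁, d₂, d₃, d₄⟩, j₁, j₂, j₃, j₄, j₅, j₆⟩
          refine ⟨by omega, ?_⟩
          obtain ⟨t₁, s₁, e₁, v₁, r₁, a₁, b₁⟩ := H (g, i) ((), j) v
            ⟨d₀, d₁, d₂, d₃, j₁, hi, j₅⟩ ⟨trivial, j₂⟩ ⟨trivial, hj⟩
          have b₁' : t₁ ≤ τ (X g) := b₁
          have v₁' : s₁.reg 10 = G g i j := v₁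
          refine ⟨_, _, .seq e₁ (.seq (.store _ _ _ _) (.seq (.add _ _ _ _) (.seq (.add _ _ _ _)
            (.sub _ _ _ _)))), ⟨⟨?_, ?_, ?_, ?_, ?_⟩, ?_, ?_, ?_, ?_, ?_, ?_⟩, by omega⟩
          · simpa [r₁ 0] using d₀
          · simpa [r₁ 1] using d₁
          · simpa [r₁ 2] using d₂
          · refine hT g v.arr _ (fun a ha => ?_) d₃
            ext c
            simp [Memory.setArr_arr, ha, a₁]
          · simpa [r₁ 8] using d₄
          · simpa [r₁ 3] using j₁
          · simp [r₁ 4, r₁ 8, j₂, d₄]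
          · simp [r₁ 5, r₁ 8, j₃, d₄, add_assoc]
          · simp [r₁ 4, r₁ 8, r₁ 1, j₂, d₄, d₁]
          · intro i' hi' j' hj'
            have hne : i' * X g + j' ≠ i * X g + j := by
              have : (i' + 1) * X g ≤ i * X g := Nat.mul_le_mul_right _ hi'
              rw [add_mul] at this
              omega
            simp [Memory.setArr_arr, r₁ 5, j₃, hne, a₁, j₅ i' hi' j' hj']
          · intro j' hj'
            simp only [Memory.setReg_arr, Memory.setArr_arr, r₁ 5 (by omega), j₃, a₁]
            by_cases hjj : j' = j
            · subst hjj
              simp [v₁']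
            · simp [hjj, j₆ j' (by omega)])
        (by
          rintro v ⟨-, j₁, j₂, j₃, j₄, -⟩
          omega)
        ((u.setReg 4 0).setReg 7 (X g))
        (by
          refine ⟨⟨?_, ?_, ?_, ?_, ?_⟩, ?_, ?_, ?_, ?_, ?_, ?_⟩ <;> simp [*])
      refine ⟨_, _, .seq (.const _ _ _) (.seq (.sub _ _ _ _) (.seq (by
        convert hu using 2
        simp [c₁]) (.seq (.add _ _ _ _) (.sub _ _ _ _)))),
        ⟨⟨?_, ?_, ?_, ?_, ?_⟩, ?_, ?_, ?_, ?_⟩, by omega⟩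
      · simpa using d₀
      · simpa using d₁
      · simpa using d₂
      · simpa using d₃
      · simpa using d₄
      · simp [j₁, d₄]
      · simp [j₃, add_mul]
      · simp [j₁, d₄, d₁]
      · intro i' hi' j' hj'
        simp only [Memory.setReg_arr]
        rcases Nat.lt_succ_iff_lt_or_eq.mp hi' with h | h
        · exact j₅ i' h j' hj'
        · subst h
          exact j₆ j' hj')
    (by
      rintro u ⟨-, i₁, i₂, i₃, -⟩
      omega)
    ((((s.setReg 3 0).setReg 5 0).setReg 8 1).setReg 6 (X g))
    (by
      refine ⟨⟨?_, ?_, ?_, ?_, ?_⟩, ?_, ?_, ?_, ?_⟩ <;> simp [*, Rows])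
  refine ⟨_, u, .seq (.const _ _ _) (.seq (.const _ _ _) (.seq (.const _ _ _) (.seq (.sub _ _ _ _)
    (by
      convert hu using 2
      simp [h1])))), ⟨c₀, c₁, c₂, hT' g _ c₃ i₄⟩, ?_⟩
  have := hle _ _ (hY g ⟨_, _, h0, h1, h2, hTA⟩)
  omega

end Programs

end RAM

/-! ### Unary automata on the states `0, …, m - 1` -/

/-- A unary automaton with states `0, …, m - 1`, transition relation `D`, initial states `I` and
accepting states `F`. -/
structure UnaryAut where
  m : ℕ
  D : ℕ → ℕ → Prop
  I : ℕ → Prop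
  F : ℕ → Prop
  lt_of_D : ∀ i j, D i j → i < m ∧ j < m
  lt_of_I : ∀ i, I i → i < m
  lt_of_F : ∀ i, F i → i < m

namespace UnaryAut

variable (A : UnaryAut)

/-- There is a path of length `t` from `i` to `j`. -/
def Rch : ℕ → ℕ → ℕ → Prop
  | 0, i, j => i = j ∧ i < A.m
  | t + 1, i, j => ∃ k, Rch t i k ∧ A.D k j

/-- Some path of length `t` leads from an initial state to `x`. -/
def Init (t x : ℕ) : Prop := ∃ i, A.I i ∧ A.Rch t i x

/-- Some path of length `k` leads from `x` to an accepting state. -/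
def Final (k x : ℕ) : Prop := ∃ j, A.Rch k x j ∧ A.F j

/-- The word of length `n` is accepted. -/
def Acc (n : ℕ) : Prop := ∃ i j, A.I i ∧ A.Rch n i j ∧ A.F j

/-- Two accepting paths of the same length are at the same state at each time. -/
def Unamb : Prop := ∀ t k x x', A.Init t x → A.Final k x → A.Init t x' → A.Final k x' → x = x'

/-- The shortest nonempty closed path through `q` has length `p`. -/
def Per (q p : ℕ) : Prop := 1 ≤ p ∧ A.Rch p q q ∧ ∀ p' < p, 1 ≤ p' → ¬A.Rch p' q q

/-- The word of length `x` is accepted by a path which is in a state of period `p` at time `m`. -/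
def S (p x : ℕ) : Prop :=
  p ≤ A.m ∧ A.m ≤ x ∧ ∃ q, A.Init A.m q ∧ A.Per q p ∧ A.Final (x - A.m) q

variable {A}

/-! ### Paths, closed paths and the periods of accepted lengths -/

theorem Rch.lt {t i j : ℕ} (h : A.Rch t i j) : i < A.m ∧ j < A.m := by
  induction t generalizing j with
  | zero => exact ⟨h.2, h.1 ▸ h.2⟩
  | succ t ih =>
    obtain ⟨k, h1, h2⟩ := h
    exact ⟨(ih h1).1, (A.lt_of_D _ _ h2).2⟩

theorem rch_add {t u i j : ℕ} : A.Rch (t + u) i j ↔ ∃ k, A.Rch t i k ∧ A.Rch u k j := by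
  induction u generalizing j with
  | zero => exact ⟨fun h => ⟨j, h, rfl, h.lt.2⟩, by rintro ⟨k, h, rfl, -⟩; exact h⟩
  | succ u ih =>
    constructor
    · rintro ⟨l, h1, h2⟩
      obtain ⟨k, h3, h4⟩ := ih.1 h1
      exact ⟨k, h3, l, h4, h2⟩
    · rintro ⟨k, h3, l, h4, h2⟩
      exact ⟨l, ih.2 ⟨k, h3, h4⟩, h2⟩

theorem Rch.trans {t u i k j : ℕ} (h : A.Rch t i k) (h' : A.Rch u k j) : A.Rch (t + u) i j :=
  rch_add.2 ⟨k, h, h'⟩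

theorem Rch.loop {p q : ℕ} (h : A.Rch p q q) (n : ℕ) : A.Rch (n * p) q q := by
  induction n with
  | zero => rw [zero_mul]; exact ⟨rfl, h.lt.1⟩
  | succ n ih => rw [add_mul, one_mul]; exact ih.trans h

theorem rch_iff_path {t i j : ℕ} : A.Rch t i j ↔
    i < A.m ∧ ∃ f : ℕ → ℕ, f 0 = i ∧ f t = j ∧ ∀ k < t, A.D (f k) (f (k + 1)) := by
  constructor
  · intro h
    refine ⟨h.lt.1, ?_⟩
    induction t generalizing j with
    | zero => exact ⟨fun _ => i, rfl, h.1, by simp⟩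
    | succ t ih =>
      obtain ⟨k, h1, h2⟩ := h
      obtain ⟨f, f0, ft, hf⟩ := ih h1
      refine ⟨Function.update f (t + 1) j, by simp [f0], by simp, fun l hl => ?_⟩
      rcases Nat.lt_succ_iff_lt_or_eq.mp hl with h | rfl
      · rw [Function.update_of_ne (by omega), Function.update_of_ne (by omega)]
        exact hf l h
      · rw [Function.update_of_ne (by omega), Function.update_self, ft]
        exact h2
  · rintro ⟨hi, f, f0, ft, hf⟩
    induction t generalizing j with
    | zero => exact ⟨by omega, hi⟩
    | succ t ih => exact ⟨f t, ih rfl fun k hk => hf k (by omega), ft ▸ hf t (by omega)⟩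

/-- A path of length at least `m` contains a nonempty closed path. -/
theorem Rch.exists_loop {n i j : ℕ} (h : A.Rch n i j) (hn : A.m ≤ n) :
    ∃ a v b c, 1 ≤ v ∧ a + v + b = n ∧ A.Rch a i c ∧ A.Rch v c c ∧ A.Rch b c j := by
  obtain ⟨hi, f, f0, ft, hf⟩ := rch_iff_path.1 h
  have key : ∀ a b, a ≤ b → b ≤ n → A.Rch (b - a) (f a) (f b) := by
    intro a b hab hb
    refine rch_iff_path.2 ⟨?_, fun t => f (a + t), rfl, by simp [hab], fun k hk =>
      hf (a + k) (by omega)⟩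
    rcases Nat.eq_zero_or_pos a with rfl | ha
    · omega
    · have := (A.lt_of_D _ _ (hf (a - 1) (by omega))).2
      rwa [show a - 1 + 1 = a by omega] at this
  have hlt : ∀ a ≤ n, f a < A.m := fun a ha => (key a n ha le_rfl).lt.1
  obtain ⟨a, ha, b, hb, hab, hfab⟩ := Finset.exists_ne_map_eq_of_card_lt_of_maps_to
    (s := Finset.range (A.m + 1)) (t := Finset.range A.m) (f := f) (by simp)
    (fun a ha => by
      simp only [Finset.coe_range, Set.mem_Iio] at ha ⊢
      exact hlt a (by omega))
  simp only [Finset.mem_range] at ha hb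
  wlog hlt' : a < b generalizing a b
  · exact this b a hab.symm hfab.symm hb ha (by omega)
  refine ⟨a, b - a, n - b, f a, by omega, by omega, ?_, ?_, ?_⟩
  · simpa [f0] using key 0 a (by omega) (by omega)
  · simpa [hfab] using key a b (by omega) (by omega)
  · simpa [hfab, ft] using key b n (by omega) le_rfl

theorem Init.trans {t u x y : ℕ} (h : A.Init t x) (h' : A.Rch u x y) : A.Init (t + u) y := by
  obtain ⟨i, hi, h⟩ := h
  exact ⟨i, hi, h.trans h'⟩

theorem Final.trans {t u x y : ℕ} (h : A.Rch u x y) (h' : A.Final t y) : A.Final (u + t) x := by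
  obtain ⟨j, h', hj⟩ := h'
  exact ⟨j, h.trans h', hj⟩

theorem acc_iff {t n : ℕ} (ht : t ≤ n) : A.Acc n ↔ ∃ x, A.Init t x ∧ A.Final (n - t) x := by
  obtain ⟨k, rfl⟩ := Nat.exists_eq_add_of_le ht
  rw [Nat.add_sub_cancel_left]
  constructor
  · rintro ⟨i, j, hi, h, hj⟩
    obtain ⟨x, h1, h2⟩ := rch_add.1 h
    exact ⟨x, ⟨i, hi, h1⟩, j, h2, hj⟩
  · rintro ⟨x, ⟨i, hi, h1⟩, j, h2, hj⟩
    exact ⟨i, j, hi, h1.trans h2, hj⟩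

/-- An accepting path with a closed path of length `p` at `q` follows it as long as a later
closed path is still ahead. -/
theorem Unamb.eq_of_loops (hA : A.Unamb) {s p g v k q x c : ℕ} (hs : A.Init s q)
    (hp : A.Rch p q q) (hx : A.Rch p q x) (hg : A.Rch g x c) (hv : A.Rch v c c) (hv1 : 1 ≤ v)
    (hk : A.Final k c) : x = q := by
  -- Two paths of equal length are compared at time `s + p`: one is at `x` and later makes `p`
  -- rounds at `c`, the other makes `v` rounds at `q` before going to `x`, and none at `c`.
  refine hA (s + p) (g + (p * v + k)) x q (hs.trans hx) (Final.trans hg (Final.trans (hv.loop p) hk))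
    (hs.trans hp) ?_
  have := Final.trans (hp.loop (v - 1)) (Final.trans hx (Final.trans hg hk))
  convert this using 1
  obtain ⟨w, rfl⟩ := Nat.exists_eq_add_of_le hv1
  rw [Nat.add_sub_cancel_left]
  ring

/-- A round at `q` can always be inserted. Conversely, after the first `p` steps from `q` at least
`m` steps remain, so another closed path lies ahead and `Unamb.eq_of_loops` shows that these `p`
steps led back to `q`; they can be cut out. -/
theorem Unamb.S_add_iff (hA : A.Unamb) {p x : ℕ} (hx : 2 * A.m ≤ x) :
    A.S p (x + p) ↔ A.S p x := by
  constructor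
  · rintro ⟨hp, -, q, hq, hper, hf⟩
    refine ⟨hp, by omega, q, hq, hper, ?_⟩
    obtain ⟨j, hj, hFj⟩ := hf
    rw [show x + p - A.m = p + (x - A.m) by omega] at hj
    obtain ⟨y, h1, h2⟩ := rch_add.1 hj
    obtain ⟨a, v, b, c, hv, -, ha, hvc, hb⟩ := h2.exists_loop (by omega)
    rw [hA.eq_of_loops hq hper.2.1 h1 ha hvc hv ⟨j, hb, hFj⟩] at h2
    exact ⟨j, h2, hFj⟩
  · rintro ⟨hp, -, q, hq, hper, hf⟩
    refine ⟨hp, by omega, q, hq, hper, ?_⟩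
    rw [show x + p - A.m = p + (x - A.m) by omega]
    exact Final.trans hper.2.1 hf

theorem Unamb.S_unique (hA : A.Unamb) {p p' x : ℕ} (h : A.S p x) (h' : A.S p' x) : p = p' := by
  obtain ⟨-, -, q, hq, hper, hf⟩ := h
  obtain ⟨-, -, q', hq', hper', hf'⟩ := h'
  obtain rfl := hA _ _ _ _ hq hf hq' hf'
  rcases lt_trichotomy p p' with h | h | h
  · exact absurd hper.2.1 (hper'.2.2 p h hper.1)
  · exact h
  · exact absurd hper'.2.1 (hper.2.2 p' h hper'.1)

theorem S.acc {p x : ℕ} (h : A.S p x) : A.Acc x := by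
  obtain ⟨-, hx, q, hq, -, hf⟩ := h
  exact (acc_iff hx).2 ⟨q, hq, hf⟩

theorem S.one_le {p x : ℕ} (h : A.S p x) : 1 ≤ p := by
  obtain ⟨-, hx, q, hq, hp, hf⟩ := h
  exact hp.1

/-- The first `m` steps contain a closed path at some `q`, and at least `m` further steps contain
another at some `c`. Trading rounds between them shows that the state `z` at time `m` is a state on
the first closed path. -/
theorem Unamb.exists_S (hA : A.Unamb) {x : ℕ} (hx : 2 * A.m ≤ x) (h : A.Acc x) :
    ∃ p, A.S p x := by
  obtain ⟨z, ⟨i, hi, hiz⟩, hz⟩ := (acc_iff (t := A.m) (by omega)).1 h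
  suffices H : ∃ p, 1 ≤ p ∧ p ≤ A.m ∧ A.Rch p z z by
    classical
    obtain ⟨p, hp, hpm, hpz⟩ := H
    have hex : ∃ p, 1 ≤ p ∧ A.Rch p z z := ⟨p, hp, hpz⟩
    refine ⟨Nat.find hex, (Nat.find_min' hex ⟨hp, hpz⟩).trans hpm, by omega, z, ⟨i, hi, hiz⟩,
      ⟨(Nat.find_spec hex).1, (Nat.find_spec hex).2, fun p' hp' h1 h2 =>
        Nat.find_min hex hp' ⟨h1, h2⟩⟩, hz⟩
  obtain ⟨a, p, b, q, hp, hab, ha, hpq, hb⟩ := hiz.exists_loop le_rfl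
  obtain ⟨j, hzj, hj⟩ := hz
  obtain ⟨g, v, k, c, hv, -, hg, hvc, hk⟩ := hzj.exists_loop (by omega)
  obtain ⟨e, f, hf, rfl⟩ : ∃ e f, f < p ∧ b = e * p + f :=
    ⟨b / p, b % p, Nat.mod_lt _ hp, by rw [mul_comm]; exact (Nat.div_add_mod b p).symm⟩
  obtain ⟨y, hy1, hy2⟩ := rch_add.1 (show A.Rch (f + (p - f)) q q by
    rwa [Nat.add_sub_cancel' hf.le])
  -- Here `y` is reached `f` steps around the closed path from `q`. One path is at `z` at time `m`
  -- and makes `p * (e + 1)` rounds at `c`. The other makes `e + 1` rounds at `q` first, is at `y`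
  -- at time `m` because `a + (e + 1) * p + f = m`, and compensates with `(e + 1) * (v - 1)` further
  -- rounds at `q`.
  obtain rfl : z = y := by
    refine hA A.m (g + ((p * (e + 1)) * v + k)) z y ⟨i, hi, hiz⟩
      (Final.trans hg (Final.trans (hvc.loop _) ⟨j, hk, hj⟩)) ⟨i, hi, ?_⟩ ?_
    · have := ha.trans ((hpq.loop (e + 1)).trans hy1)
      convert this using 1
      rw [← hab]
      ring
    · have := Final.trans hy2 (Final.trans (hpq.loop ((e + 1) * (v - 1)))
        (Final.trans hb (Final.trans hg ⟨j, hk, hj⟩)))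
      convert this using 1
      obtain ⟨w, rfl⟩ := Nat.exists_eq_add_of_le hv
      obtain ⟨r, rfl⟩ := Nat.exists_eq_add_of_le hf.le
      rw [Nat.add_sub_cancel_left, Nat.add_sub_cancel_left]
      ring
  refine ⟨p, hp, by omega, ?_⟩
  simpa [Nat.sub_add_cancel hf.le] using hy2.trans hy1

end UnaryAut

/-! ### The complement as a disjoint union of residue classes -/

/-- The product of `m`, `m / 2`, `m / 4`, … down to `1`. -/
def halvingProd (m : ℕ) : ℕ := if _h : m = 0 then 1 else m * halvingProd (m / 2)
  decreasing_by omega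

theorem halvingProd_zero : halvingProd 0 = 1 := by rw [halvingProd]; simp

theorem halvingProd_of_pos {m : ℕ} (h : 1 ≤ m) : halvingProd m = m * halvingProd (m / 2) := by
  rw [halvingProd, dif_neg (by omega)]

theorem halvingProd_pos (m : ℕ) : 1 ≤ halvingProd m := by
  induction m using Nat.strong_induction_on with
  | _ m ih =>
    rcases Nat.eq_zero_or_pos m with rfl | h
    · rw [halvingProd_zero]
    · rw [halvingProd_of_pos h]
      exact Nat.mul_pos h (ih _ (by omega))

theorem halvingProd_half_le (m : ℕ) : halvingProd (m / 2) ≤ halvingProd m := by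
  rcases Nat.eq_zero_or_pos m with rfl | h
  · rfl
  · rw [halvingProd_of_pos h]
    exact Nat.le_mul_of_pos_left _ h

/-! ### Refinement of residue classes -/

namespace UnaryAut

variable (A : UnaryAut)

/-- A bound for the length of the initial path and of the cycles of the complement automaton. -/
def W : ℕ := halvingProd A.m + 2 * A.m + 2

/-- The number of states of the complement automaton. -/
def X : ℕ := A.W * A.W

/-- Some word whose length is `x` modulo `P` is accepted with period `p`. -/
def Live (P x p : ℕ) : Prop := ∃ y < A.X, 2 * A.m ≤ y ∧ y ≡ x [MOD P] ∧ A.S p y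

/-- `v` is a multiple of `P` and of the period of some word with length `x` modulo `P`. -/
def Refines (P x v : ℕ) : Prop :=
  1 ≤ v ∧ P ∣ v ∧ ((∃ p < A.X, A.Live P x p) → ∃ p < A.X, A.Live P x p ∧ p ∣ v)

/-- Iterated refinement of the residue class of `x`. -/
noncomputable def path : ℕ → ℕ → ℕ
  | 0, _ => 1
  | k + 1, x => RAM.least A.X (A.Refines (path k x) x)

/-- No word with length `b` modulo `a` is accepted, and `a` is the final modulus for `b`. -/
def Leaf (a b : ℕ) : Prop := b < a ∧ A.path A.m b = a ∧ ¬∃ p < A.X, A.Live a b p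

variable {A}

/-- This makes the cutoff `y < X` in `Live` harmless, and keeps the lcm of a modulus and a period
within the range of the search in `path`. -/
theorem mul_add_lt_X {P : ℕ} (hP : P ≤ halvingProd A.m) : P * A.m + 2 * A.m < A.X := by
  have h1 : P * A.m ≤ A.W * A.m := Nat.mul_le_mul_right _ (by unfold W; omega)
  have h2 : A.W * (A.m + 2) ≤ A.X := Nat.mul_le_mul_left _ (by
    have := halvingProd_pos A.m
    unfold W; omega)
  have h3 : 2 * A.m < A.W := by unfold W; omega
  rw [mul_add] at h2
  omega

theorem m_lt_X : A.m < A.X := by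
  have := mul_add_lt_X (A := A) (P := 1) (halvingProd_pos _)
  omega

theorem Unamb.S_congr (hA : A.Unamb) {p x y : ℕ} (hx : 2 * A.m ≤ x) (hy : 2 * A.m ≤ y)
    (h : x ≡ y [MOD p]) : A.S p x ↔ A.S p y := by
  have key : ∀ k x, 2 * A.m ≤ x → (A.S p (x + k * p) ↔ A.S p x) := by
    intro k
    induction k with
    | zero => simp
    | succ k ih =>
      intro x hx
      rw [add_mul, one_mul, ← add_assoc, hA.S_add_iff (by omega), ih x hx]
  wlog hxy : x ≤ y generalizing x y
  · exact (this hy hx h.symm (by omega)).symm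
  obtain ⟨c, hc⟩ := (Nat.modEq_iff_dvd' hxy).1 h
  obtain rfl : y = x + c * p := by rw [mul_comm, ← hc]; omega
  exact (key c x hx).symm

theorem Live.le {P x p : ℕ} (h : A.Live P x p) : 1 ≤ p ∧ p ≤ A.m := by
  obtain ⟨y, -, -, -, hS⟩ := h
  exact ⟨hS.one_le, hS.1⟩

theorem Live.lt_X {P x p : ℕ} (h : A.Live P x p) : p < A.X := h.le.2.trans_lt m_lt_X

/-- Reducing `y - 2 * m` modulo `P * p` changes neither the class modulo `P` nor membership in `S
p`, and brings `y` below `P * m + 2 * m`. -/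
theorem Unamb.live_of_S (hA : A.Unamb) {P x y p : ℕ} (h1 : 1 ≤ P) (hP : P ≤ halvingProd A.m)
    (hy : 2 * A.m ≤ y) (hyx : y ≡ x [MOD P]) (hS : A.S p y) : A.Live P x p := by
  have hmod : 2 * A.m + (y - 2 * A.m) % (P * p) ≡ y [MOD P * p] := by
    have : 2 * A.m + (y - 2 * A.m) % (P * p) ≡ 2 * A.m + (y - 2 * A.m) [MOD P * p] :=
      Nat.ModEq.add_left _ (Nat.mod_modEq _ _)
    rwa [Nat.add_sub_cancel' hy] at this
  refine ⟨2 * A.m + (y - 2 * A.m) % (P * p), ?_, by omega, ?_, ?_⟩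
  · have := mul_add_lt_X hP
    have h2 : (y - 2 * A.m) % (P * p) < P * p := Nat.mod_lt _ (Nat.mul_pos h1 hS.one_le)
    have h3 : P * p ≤ P * A.m := Nat.mul_le_mul_left _ hS.1
    omega
  · exact (hmod.of_mul_right p).trans hyx
  · exact (hA.S_congr (by omega) hy (hmod.of_mul_left P)).2 hS

theorem live_congr {P x x' p : ℕ} (h : x ≡ x' [MOD P]) : A.Live P x p ↔ A.Live P x' p :=
  ⟨fun ⟨y, h1, h2, h3, h4⟩ => ⟨y, h1, h2, h3.trans h, h4⟩,
    fun ⟨y, h1, h2, h3, h4⟩ => ⟨y, h1, h2, h3.trans h.symm, h4⟩⟩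

theorem refines_congr {P x x' : ℕ} (h : x ≡ x' [MOD P]) : A.Refines P x = A.Refines P x' := by
  funext v
  simp only [Refines, live_congr h]

/-- Two periods which are live in the same residue class share a factor which is not yet in the
modulus. -/
theorem Unamb.gcd_ne (hA : A.Unamb) {P x p p' : ℕ} (h1 : 1 ≤ P) (h : A.Live P x p)
    (h' : A.Live P x p') (hne : p ≠ p') : p'.gcd (P.lcm p) ≠ p'.gcd P := by
  intro hg
  obtain ⟨y, -, hy, hyx, hS⟩ := h
  obtain ⟨y', -, hy', hyx', hS'⟩ := h'
  have hc : y ≡ y' [MOD (P.lcm p).gcd p'] := by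
    rw [Nat.gcd_comm, hg]
    exact (hyx.trans hyx'.symm).of_dvd (Nat.gcd_dvd_right _ _)
  -- The solution satisfies the conditions for both periods; a multiple of both moduli is then added
  -- to get beyond `2 * m`, where `S_unique` gives the contradiction.
  obtain ⟨z, hz, hz'⟩ := Nat.chineseRemainder' hc
  have hpos : 1 ≤ P.lcm p * p' := Nat.mul_pos (Nat.lcm_pos h1 hS.one_le) hS'.one_le
  have hle : 2 * A.m ≤ z + 2 * A.m * (P.lcm p * p') := by
    have : 2 * A.m * 1 ≤ 2 * A.m * (P.lcm p * p') := Nat.mul_le_mul_left _ hpos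
    omega
  have hzz : ∀ d, d ∣ P.lcm p * p' → z + 2 * A.m * (P.lcm p * p') ≡ z [MOD d] := fun d hd =>
    Nat.ModEq.add_left z (Nat.modEq_zero_iff_dvd.2 (hd.mul_left _))
  refine hne (hA.S_unique (x := z + 2 * A.m * (P.lcm p * p')) ?_ ?_)
  · refine (hA.S_congr hle hy ?_).2 hS
    exact (hzz p ((Nat.dvd_lcm_right P p).mul_right _)).trans (hz.of_dvd (Nat.dvd_lcm_right P p))
  · refine (hA.S_congr hle hy' ?_).2 hS'
    exact (hzz p' (Dvd.intro_left _ rfl)).trans hz'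

theorem path_succ_eq {k x v : ℕ} (hv : v < A.X) (h : A.Refines (A.path k x) x v)
    (hmin : ∀ u < v, ¬A.Refines (A.path k x) x u) : A.path (k + 1) x = v :=
  RAM.least_eq hv h hmin

theorem path_succ_of_refines {k x : ℕ} (hP : A.path k x ≤ halvingProd A.m)
    (h : A.Refines (A.path k x) x (A.path k x)) : A.path (k + 1) x = A.path k x := by
  refine path_succ_eq ?_ h fun u hu hr => ?_
  · have h1 : A.path k x < A.W := by unfold W; omega
    have h2 : A.W * 1 ≤ A.X := Nat.mul_le_mul_left _ (by unfold W; omega)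
    omega
  · have := Nat.le_of_dvd hr.1 hr.2.1
    omega

/-- Every lcm of the modulus with a live period is a refinement, and every refinement is a multiple
of such an lcm, so the least refinement is one of them. -/
theorem path_succ_of_live {k x p : ℕ} (h1 : 1 ≤ A.path k x) (hP : A.path k x ≤ halvingProd A.m)
    (h : A.Live (A.path k x) x p) :
    ∃ p', A.Live (A.path k x) x p' ∧ A.path (k + 1) x = (A.path k x).lcm p' := by
  classical
  have key : ∀ p, A.Live (A.path k x) x p →
      A.Refines (A.path k x) x ((A.path k x).lcm p) := fun p hp =>
    ⟨Nat.lcm_pos h1 hp.le.1, Nat.dvd_lcm_left _ _, fun _ => ⟨p, hp.lt_X, hp, Nat.dvd_lcm_right _ _⟩⟩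
  have hex : ∃ v, A.Refines (A.path k x) x v := ⟨_, key p h⟩
  have hle : ∀ p, A.Live (A.path k x) x p → Nat.find hex ≤ (A.path k x).lcm p := fun p hp =>
    Nat.find_min' hex (key p hp)
  have hspec := Nat.find_spec hex
  obtain ⟨p', -, hp', hdvd⟩ := hspec.2.2 ⟨p, h.lt_X, h⟩
  refine ⟨p', hp', ?_⟩
  rw [← le_antisymm (hle p' hp') (Nat.le_of_dvd hspec.1 (Nat.lcm_dvd hspec.2.1 hdvd))]
  refine path_succ_eq ?_ hspec fun u hu => Nat.find_min hex hu
  have h2 := mul_add_lt_X hP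
  have h3 : (A.path k x).lcm p ≤ A.path k x * p :=
    Nat.le_of_dvd (Nat.mul_pos h1 h.le.1) (Nat.lcm_dvd_mul _ _)
  have h4 : A.path k x * p ≤ A.path k x * A.m := Nat.mul_le_mul_left _ h.le.2
  have := hle p h
  omega

/-- The potential `P * halvingProd (m / 2 ^ k)` does not increase: step `k` multiplies `P` by `p /
gcd p P ≤ m / 2 ^ k`, which is the factor that `halvingProd` loses. In the first alternative `p`
divides the modulus, so all lengths of the class from `2 * m` on have period `p`. -/
theorem Unamb.path_invariant (hA : A.Unamb) (k x : ℕ) : 1 ≤ A.path k x ∧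
    A.path k x * halvingProd (A.m / 2 ^ k) ≤ halvingProd A.m ∧
    ((∃ p, A.Live (A.path k x) x p ∧ p ∣ A.path k x) ∨
      ∀ p, A.Live (A.path k x) x p → p / p.gcd (A.path k x) ≤ A.m / 2 ^ k) := by
  induction k with
  | zero => exact ⟨le_rfl, by simp [path], Or.inr fun p hp => by simpa [path] using hp.le.2⟩
  | succ k ih =>
    obtain ⟨h1, hle, hor⟩ := ih
    have hhalf : A.m / 2 ^ (k + 1) = A.m / 2 ^ k / 2 := by rw [pow_succ, Nat.div_div_eq_div_mul]
    have hmono := halvingProd_half_le (A.m / 2 ^ k)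
    rw [← hhalf] at hmono
    have hP : A.path k x ≤ halvingProd A.m :=
      (Nat.le_mul_of_pos_right _ (halvingProd_pos _)).trans hle
    by_cases hc : ∃ p, A.Live (A.path k x) x p ∧ p ∣ A.path k x
    · obtain ⟨p, hp, hd⟩ := hc
      rw [path_succ_of_refines hP ⟨h1, dvd_rfl, fun _ => ⟨p, hp.lt_X, hp, hd⟩⟩]
      exact ⟨h1, (Nat.mul_le_mul_left _ hmono).trans hle, Or.inl ⟨p, hp, hd⟩⟩
    by_cases hl : ∃ p, A.Live (A.path k x) x p
    · have hrel := hor.resolve_left hc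
      obtain ⟨p₀, hp₀⟩ := hl
      obtain ⟨p, hp, heq⟩ := path_succ_of_live h1 hP hp₀
      have hmulcm : ∀ q, A.path k x * (q / q.gcd (A.path k x)) = (A.path k x).lcm q := fun q => by
        rw [Nat.lcm, Nat.gcd_comm, Nat.mul_div_assoc _ (Nat.gcd_dvd_right _ _)]
      have hpos : 1 ≤ (A.path k x).lcm p := Nat.lcm_pos h1 hp.le.1
      have hdvd : A.path k x ∣ (A.path k x).lcm p := Nat.dvd_lcm_left _ _
      rw [heq]
      refine ⟨hpos, ?_, ?_⟩
      · have hr := hrel p hp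
        have hr1 : 1 ≤ p / p.gcd (A.path k x) :=
          Nat.div_pos (Nat.gcd_le_left _ hp.le.1) (Nat.gcd_pos_of_pos_left _ hp.le.1)
        rw [← hmulcm]
        calc A.path k x * (p / p.gcd (A.path k x)) * halvingProd (A.m / 2 ^ (k + 1))
            ≤ A.path k x * (A.m / 2 ^ k) * halvingProd (A.m / 2 ^ k / 2) := by
              rw [hhalf]
              gcongr
          _ = A.path k x * halvingProd (A.m / 2 ^ k) := by
              rw [halvingProd_of_pos (hr1.trans hr), mul_assoc]
          _ ≤ _ := hle
      -- If `p` stays live, the first alternative holds from now on. Otherwise each surviving `p'`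
      -- differs from `p`, so its gcd with the modulus has grown by a factor `c ≥ 2`.
      · by_cases hlp : A.Live ((A.path k x).lcm p) x p
        · exact Or.inl ⟨p, hlp, Nat.dvd_lcm_right _ _⟩
        · refine Or.inr fun p' hp' => ?_
          have hlive' : A.Live (A.path k x) x p' := by
            obtain ⟨y, a, b, c, d⟩ := hp'
            exact ⟨y, a, b, c.of_dvd hdvd, d⟩
          have hne := hA.gcd_ne h1 hp hlive' (by rintro rfl; exact hlp hp')
          obtain ⟨c, hcg⟩ : p'.gcd (A.path k x) ∣ p'.gcd ((A.path k x).lcm p) :=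
            Nat.gcd_dvd_gcd_of_dvd_right _ hdvd
          have hg : 1 ≤ p'.gcd (A.path k x) := Nat.gcd_pos_of_pos_left _ hp'.le.1
          have hg' : 1 ≤ p'.gcd ((A.path k x).lcm p) := Nat.gcd_pos_of_pos_left _ hp'.le.1
          have hc2 : 2 ≤ c := by
            by_contra hlt
            obtain rfl | rfl : c = 0 ∨ c = 1 := by omega
            · omega
            · omega
          rw [hhalf, hcg, ← Nat.div_div_eq_div_mul]
          calc p' / p'.gcd (A.path k x) / c ≤ p' / p'.gcd (A.path k x) / 2 :=
                Nat.div_le_div_left hc2 (by norm_num)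
            _ ≤ _ := Nat.div_le_div_right (hrel p' hlive')
    · have hl' : ¬∃ p < A.X, A.Live (A.path k x) x p := fun ⟨p, _, hp⟩ => hl ⟨p, hp⟩
      rw [path_succ_of_refines hP ⟨h1, dvd_rfl, fun h => absurd h hl'⟩]
      exact ⟨h1, (Nat.mul_le_mul_left _ hmono).trans hle, Or.inr fun p hp => absurd ⟨p, hp⟩ hl⟩

theorem Unamb.path_le (hA : A.Unamb) (k x : ℕ) : A.path k x ≤ halvingProd A.m :=
  (Nat.le_mul_of_pos_right _ (halvingProd_pos _)).trans (hA.path_invariant k x).2.1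

theorem Unamb.path_dvd (hA : A.Unamb) (k l x : ℕ) : A.path k x ∣ A.path (k + l) x := by
  induction l with
  | zero => exact dvd_rfl
  | succ l ih =>
    refine ih.trans ?_
    have h1 := (hA.path_invariant (k + l) x).1
    have hP := hA.path_le (k + l) x
    by_cases hl : ∃ p, A.Live (A.path (k + l) x) x p
    · obtain ⟨p, hp⟩ := hl
      obtain ⟨p', -, h⟩ := path_succ_of_live h1 hP hp
      rw [← add_assoc, h]
      exact Nat.dvd_lcm_left _ _
    · rw [← add_assoc, path_succ_of_refines hP
        ⟨h1, dvd_rfl, fun ⟨p, _, hp⟩ => absurd ⟨p, hp⟩ hl⟩]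

/-- The moduli form a divisibility chain, so `x` and `x'` agree modulo each of them, and each
refinement depends only on the class. -/
theorem Unamb.path_congr (hA : A.Unamb) {K x x' : ℕ} (h : x ≡ x' [MOD A.path K x]) :
    A.path K x' = A.path K x := by
  suffices H : ∀ k ≤ K, A.path k x' = A.path k x from H K le_rfl
  intro k
  induction k with
  | zero => intro _; rfl
  | succ k ih =>
    intro hk
    obtain ⟨l, rfl⟩ := Nat.exists_eq_add_of_le (show k ≤ K by omega)
    show RAM.least _ _ = RAM.least _ _
    rw [ih (by omega), refines_congr (h.of_dvd (hA.path_dvd k l x)).symm]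

/-- After `m` steps a live period cannot survive: if one divides the modulus, periodicity makes `x`
itself accepted, and otherwise the positive number `p / gcd p P` would be at most `m / 2 ^ m = 0`.
-/
theorem Unamb.leaf_of_not_acc (hA : A.Unamb) {x : ℕ} (hx : 2 * A.m ≤ x) (h : ¬A.Acc x) :
    A.Leaf (A.path A.m x) (x % A.path A.m x) := by
  obtain ⟨h1, -, hor⟩ := hA.path_invariant A.m x
  have hmod : x % A.path A.m x ≡ x [MOD A.path A.m x] := Nat.mod_modEq _ _
  refine ⟨Nat.mod_lt _ h1, hA.path_congr hmod.symm, ?_⟩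
  rintro ⟨p, -, hp⟩
  rw [live_congr hmod] at hp
  rcases hor with ⟨p, ⟨y, -, hy, hyx, hS⟩, hd⟩ | hor
  · exact h ((hA.S_congr hy hx (hyx.of_dvd hd)).1 hS).acc
  · have hr := hor p hp
    rw [Nat.div_eq_of_lt (Nat.lt_two_pow_self)] at hr
    have : 1 ≤ p / p.gcd (A.path A.m x) :=
      Nat.div_pos (Nat.gcd_le_left _ hp.le.1) (Nat.gcd_pos_of_pos_left _ hp.le.1)
    omega

/-- The modulus of a leaf is recovered from any of its elements, so distinct leaves are disjoint;
unambiguity of the complement rests on this. -/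
theorem Unamb.eq_of_leaf (hA : A.Unamb) {a x : ℕ} (h : A.Leaf a (x % a)) : a = A.path A.m x := by
  have := hA.path_congr (K := A.m) (x := x % a) (x' := x) (by rw [h.2.1]; exact Nat.mod_modEq _ _)
  rw [this, h.2.1]

theorem Unamb.not_acc_of_leaf (hA : A.Unamb) {a x : ℕ} (hx : 2 * A.m ≤ x) (h : A.Leaf a (x % a)) :
    ¬A.Acc x := by
  intro hacc
  obtain ⟨p, hp⟩ := hA.exists_S hx hacc
  have ha := hA.eq_of_leaf h
  have h1 : 1 ≤ a := by
    have := h.1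
    omega
  have hl := hA.live_of_S h1 (ha ▸ hA.path_le _ _) hx (Nat.mod_modEq x a).symm hp
  exact h.2.2 ⟨p, hl.lt_X, hl⟩

end UnaryAut

/-! ### Unary nondeterministic automata -/

theorem NFA.mem_evalFrom_iff {α σ : Type*} (M : NFA α σ) (w : List α) (S : Set σ) (q : σ) :
    q ∈ M.evalFrom S w ↔ ∃ r : Fin (w.length + 1) → σ, r 0 ∈ S ∧
      (∀ i : Fin w.length, r i.succ ∈ M.step (r i.castSucc) (w.get i)) ∧
      r (Fin.last w.length) = q := by
  induction w generalizing S with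
  | nil =>
    constructor
    · intro h
      exact ⟨fun _ => q, h, fun i => i.elim0, rfl⟩
    · rintro ⟨r, h, -, rfl⟩
      exact h
  | cons a w ih =>
    rw [NFA.evalFrom_cons, ih]
    constructor
    · rintro ⟨r, h0, hr, hl⟩
      obtain ⟨p, hp, hpr⟩ := (NFA.mem_stepSet).1 h0
      refine ⟨Fin.cons p r, hp, fun i => ?_, by simpa [← Fin.succ_last] using hl⟩
      induction i using Fin.cases with
      | zero => simpa using hpr
      | succ i => simpa using hr i
    · rintro ⟨r, h0, hr, hl⟩
      exact ⟨fun i => r i.succ, NFA.mem_stepSet.2 ⟨r 0, h0, hr 0⟩, fun i => hr i.succ, hl⟩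

theorem NFA.mem_accepts_iff_exists_run {α σ : Type*} (M : NFA α σ) (w : List α) :
    w ∈ M.accepts ↔ ∃ r, M.IsAcceptingRun w r := by
  rw [NFA.mem_accepts]
  constructor
  · rintro ⟨q, hq, h⟩
    obtain ⟨r, h0, hr, rfl⟩ := (M.mem_evalFrom_iff w _ q).1 h
    exact ⟨r, h0, hr, hq⟩
  · rintro ⟨r, h0, hr, hq⟩
    exact ⟨_, hq, (M.mem_evalFrom_iff w _ _).2 ⟨r, h0, hr, rfl⟩⟩

/-! ### Accepting runs as paths on natural numbers -/

namespace UnaryAut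

/-- The states of a unary nondeterministic automaton as natural numbers. -/
def ofNFA {m : ℕ} (M : NFA Unit (Fin m)) : UnaryAut where
  m := m
  D i j := ∃ i' j' : Fin m, i' = i ∧ j' = j ∧ j' ∈ M.step i' ()
  I i := ∃ i' : Fin m, i' = i ∧ i' ∈ M.start
  F i := ∃ i' : Fin m, i' = i ∧ i' ∈ M.accept
  lt_of_D := by rintro _ _ ⟨i, j, rfl, rfl, -⟩; exact ⟨i.2, j.2⟩
  lt_of_I := by rintro _ ⟨i, rfl, -⟩; exact i.2
  lt_of_F := by rintro _ ⟨i, rfl, -⟩; exact i.2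

variable {m : ℕ} {M : NFA Unit (Fin m)}

@[simp] theorem ofNFA_D {i j : Fin m} : (ofNFA M).D i j ↔ j ∈ M.step i () :=
  ⟨fun ⟨_, _, h, h', hs⟩ => Fin.ext h ▸ Fin.ext h' ▸ hs, fun h => ⟨i, j, rfl, rfl, h⟩⟩

@[simp] theorem ofNFA_I {i : Fin m} : (ofNFA M).I i ↔ i ∈ M.start :=
  ⟨fun ⟨_, h, hs⟩ => Fin.ext h ▸ hs, fun h => ⟨i, rfl, h⟩⟩

@[simp] theorem ofNFA_F {i : Fin m} : (ofNFA M).F i ↔ i ∈ M.accept :=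
  ⟨fun ⟨_, h, hs⟩ => Fin.ext h ▸ hs, fun h => ⟨i, rfl, h⟩⟩

theorem isAcceptingRun_iff {w : List Unit} {r : Fin (w.length + 1) → Fin m} :
    M.IsAcceptingRun w r ↔ (ofNFA M).I (r 0) ∧
      (∀ i : Fin w.length, (ofNFA M).D (r i.castSucc) (r i.succ)) ∧
      (ofNFA M).F (r (Fin.last w.length)) := by
  simp [NFA.IsAcceptingRun]

theorem exists_run_of_path {w : List Unit} {f : ℕ → ℕ} (h0 : (ofNFA M).I (f 0))
    (hf : ∀ k < w.length, (ofNFA M).D (f k) (f (k + 1))) (hF : (ofNFA M).F (f w.length)) :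
    ∃ r, M.IsAcceptingRun w r ∧ ∀ i, (r i : ℕ) = f i := by
  have hlt : ∀ i ≤ w.length, f i < m := fun i hi => by
    rcases Nat.eq_zero_or_pos i with rfl | h
    · exact (ofNFA M).lt_of_I _ h0
    · have := ((ofNFA M).lt_of_D _ _ (hf (i - 1) (by omega))).2
      rwa [show i - 1 + 1 = i by omega] at this
  exact ⟨fun i => ⟨f i, hlt i (by omega)⟩,
    isAcceptingRun_iff.2 ⟨h0, fun i => hf i i.2, hF⟩, fun i => rfl⟩

theorem exists_path_of_init_final {A : UnaryAut} {t k x : ℕ} (h : A.Init t x)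
    (h' : A.Final k x) : ∃ f : ℕ → ℕ, A.I (f 0) ∧ f t = x ∧
      (∀ l < t + k, A.D (f l) (f (l + 1))) ∧ A.F (f (t + k)) := by
  obtain ⟨i, hi, h⟩ := h
  obtain ⟨j, h', hj⟩ := h'
  obtain ⟨-, f, f0, ft, hf⟩ := rch_iff_path.1 h
  obtain ⟨-, g, g0, gk, hg⟩ := rch_iff_path.1 h'
  refine ⟨fun l => if l < t then f l else g (l - t), ?_, by simp [g0], fun l hl => ?_, ?_⟩
  · by_cases ht : 0 < t
    · simpa [ht, f0] using hi
    · obtain rfl : t = 0 := by omega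
      simp only [lt_irrefl, if_false, Nat.sub_zero]
      rwa [g0, ← ft, f0]
  · by_cases h1 : l + 1 < t
    · simp only [h1, show l < t by omega, if_true]
      exact hf l (by omega)
    · by_cases h2 : l < t
      · obtain rfl : t = l + 1 := by omega
        simp only [lt_irrefl, h2, if_true, if_false, Nat.sub_self, g0, ← ft]
        exact hf l h2
      · simp only [h1, h2, if_false, show l + 1 - t = l - t + 1 by omega]
        exact hg _ (by omega)
  · simpa [gk] using hj

theorem mem_accepts_iff_acc (w : List Unit) : w ∈ M.accepts ↔ (ofNFA M).Acc w.length := by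
  rw [NFA.mem_accepts_iff_exists_run]
  constructor
  · rintro ⟨r, hr⟩
    rw [isAcceptingRun_iff] at hr
    have key : ∀ k (hk : k < w.length + 1), (ofNFA M).Rch k (r 0) (r ⟨k, hk⟩) := by
      intro k
      induction k with
      | zero => exact fun _ => ⟨rfl, (r 0).2⟩
      | succ k ih => exact fun hk => ⟨_, ih (by omega), hr.2.1 ⟨k, by omega⟩⟩
    exact ⟨_, _, hr.1, key w.length (by omega), hr.2.2⟩
  · intro h
    obtain ⟨x, h1, h2⟩ := (acc_iff le_rfl).1 h
    rw [Nat.sub_self] at h2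
    obtain ⟨f, hI, -, hD, hF⟩ := exists_path_of_init_final h1 h2
    obtain ⟨r, hr, -⟩ := exists_run_of_path hI hD hF
    exact ⟨r, hr⟩

theorem unamb_ofNFA (hM : M.IsUnambiguous) : (ofNFA M).Unamb := by
  intro t k x x' h1 h2 h1' h2'
  obtain ⟨f, hI, hx, hD, hF⟩ := exists_path_of_init_final h1 h2
  obtain ⟨f', hI', hx', hD', hF'⟩ := exists_path_of_init_final h1' h2'
  obtain ⟨n, hn⟩ : ∃ n, n = t + k := ⟨_, rfl⟩
  rw [← hn] at hD hF hD' hF'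
  have hlen : (List.replicate n ()).length = n := by simp
  rw [← hlen] at hD hF hD' hF'
  obtain ⟨r, hr, hrf⟩ := exists_run_of_path hI hD hF
  obtain ⟨r', hr', hrf'⟩ := exists_run_of_path hI' hD' hF'
  have hmem := (M.mem_accepts_iff_exists_run _).2 ⟨r, hr⟩
  have heq := (hM.1 _ hmem).unique hr hr'
  have ht : t < (List.replicate n ()).length + 1 := by omega
  have e1 := hrf ⟨t, ht⟩
  have e2 := hrf' ⟨t, ht⟩
  rw [heq] at e1
  simp only at e1 e2
  omega

/-! ### The complement automaton -/

variable (A : UnaryAut)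

/-- The transitions of the complement automaton: row `0` is an initial path, and row `a ≥ 1`
contains a cycle of length `a`. -/
def CoStep (a b a' b' : ℕ) : Prop :=
  (a = 0 ∧ a' = 0 ∧ b' = b + 1) ∨ (a = 0 ∧ b + 1 = A.W ∧ b' < a' ∧ A.W ≡ b' [MOD a']) ∨
    (b < a ∧ a' = a ∧ b' < a ∧ (b' = b + 1 ∨ b + 1 = a ∧ b' = 0))

/-- Transitions between encoded states of the complement automaton. -/
def CoD (y z : ℕ) : Prop := ∃ a < A.X, ∃ b < A.X, ∃ a' < A.X, ∃ b' < A.X,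
  ((a < A.W ∧ b < A.W) ∧ (a' < A.W ∧ b' < A.W)) ∧ (y = a * A.W + b ∧ z = a' * A.W + b') ∧
    A.CoStep a b a' b'

/-- Encoded accepting states of the complement automaton. -/
def CoF (y : ℕ) : Prop := ∃ a < A.X, ∃ b < A.X, (a < A.W ∧ b < A.W) ∧ y = a * A.W + b ∧
  ((a = 0 ∧ ¬A.Acc b) ∨ A.Leaf a b)

/-- The complement automaton. -/
def compl : NFA Unit (Fin A.X) where
  step y _ := {z | A.CoD y z}
  start := {y | (y : ℕ) = 0}
  accept := {y | A.CoF y}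

variable {A}

theorem two_le_W : 2 ≤ A.W := by unfold W; omega

theorem W_le_X : A.W ≤ A.X := Nat.le_mul_of_pos_left _ (by have := two_le_W (A := A); omega)

theorem code_lt {a b : ℕ} (ha : a < A.W) (hb : b < A.W) : a * A.W + b < A.X := by
  have : (a + 1) * A.W ≤ A.W * A.W := Nat.mul_le_mul_right _ ha
  rw [add_mul] at this
  unfold X
  omega

theorem code_inj {a b c d : ℕ} (hb : b < A.W) (hd : d < A.W)
    (h : a * A.W + b = c * A.W + d) : a = c ∧ b = d := by
  have h1 := congrArg (· / A.W) h
  have h2 := congrArg (· % A.W) h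
  simp only [Nat.mul_add_mod', Nat.mod_eq_of_lt hb, Nat.mod_eq_of_lt hd] at h2
  have hpos : 0 < A.W := by omega
  simp only [mul_comm _ A.W, Nat.mul_add_div hpos, Nat.div_eq_of_lt hb, Nat.div_eq_of_lt hd,
    add_zero] at h1
  exact ⟨h1, h2⟩

theorem coD_code {a b a' b' : ℕ} (ha : a < A.W) (hb : b < A.W) (ha' : a' < A.W) (hb' : b' < A.W) :
    A.CoD (a * A.W + b) (a' * A.W + b') ↔ A.CoStep a b a' b' := by
  have := W_le_X (A := A)
  constructor
  · rintro ⟨c, -, d, -, c', -, d', -, ⟨⟨-, hd⟩, -, hd'⟩, ⟨h, h'⟩, hs⟩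
    obtain ⟨rfl, rfl⟩ := code_inj hb hd h
    obtain ⟨rfl, rfl⟩ := code_inj hb' hd' h'
    exact hs
  · exact fun hs => ⟨a, by omega, b, by omega, a', by omega, b', by omega, ⟨⟨ha, hb⟩, ha', hb'⟩,
      ⟨rfl, rfl⟩, hs⟩

theorem coF_code {a b : ℕ} (ha : a < A.W) (hb : b < A.W) :
    A.CoF (a * A.W + b) ↔ ((a = 0 ∧ ¬A.Acc b) ∨ A.Leaf a b) := by
  have := W_le_X (A := A)
  constructor
  · rintro ⟨c, -, d, -, ⟨-, hd⟩, h, hs⟩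
    obtain ⟨rfl, rfl⟩ := code_inj hb hd h
    exact hs
  · exact fun hs => ⟨a, by omega, b, by omega, ⟨ha, hb⟩, rfl, hs⟩

/-! ### Runs of the complement automaton -/

variable (A) in
/-- The state after `t` steps on the way to the cycle of length `a`. -/
def coPath (a t : ℕ) : ℕ := if t < A.W then 0 * A.W + t else a * A.W + t % a

theorem coPath_of_lt {a t : ℕ} (h : t < A.W) : A.coPath a t = 0 * A.W + t := if_pos h

theorem coPath_of_le {a t : ℕ} (h : A.W ≤ t) : A.coPath a t = a * A.W + t % a :=
  if_neg (by omega)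

theorem mod_add_one_cases {a : ℕ} (ha : 1 ≤ a) (t : ℕ) :
    (t + 1) % a = t % a + 1 ∨ t % a + 1 = a ∧ (t + 1) % a = 0 := by
  have h1 := Nat.mod_lt t ha
  rcases Nat.lt_or_ge (t % a + 1) a with h | h
  · left
    rw [Nat.add_mod, Nat.mod_eq_of_lt (a := 1) (by omega), Nat.mod_eq_of_lt h]
  · right
    have h2 : t % a + 1 = a := by omega
    refine ⟨h2, ?_⟩
    rw [← Nat.mod_add_mod, h2, Nat.mod_self]

theorem coD_coPath {a t : ℕ} (ha : 1 ≤ a) (haW : a < A.W) :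
    A.CoD (A.coPath a t) (A.coPath a (t + 1)) := by
  have hlt : ∀ t, t % a < a := fun t => Nat.mod_lt t ha
  have hlt1 := hlt t
  have hlt2 := hlt (t + 1)
  rcases lt_trichotomy (t + 1) A.W with h | h | h
  · rw [coPath_of_lt h, coPath_of_lt (by omega), coD_code (by omega) (by omega) (by omega) h]
    exact Or.inl ⟨rfl, rfl, rfl⟩
  · rw [coPath_of_le h.ge, coPath_of_lt (by omega),
      coD_code (by omega) (by omega) haW (by omega)]
    exact Or.inr (Or.inl ⟨rfl, h, hlt2, h ▸ (Nat.mod_modEq _ _).symm⟩)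
  · rw [coPath_of_le h.le, coPath_of_le (by omega),
      coD_code (by omega) (by omega) haW (by omega)]
    exact Or.inr (Or.inr ⟨hlt1, rfl, hlt2, mod_add_one_cases ha t⟩)

/-- The only nondeterministic choice is that of the cycle at the end of the stem; its entry point is
fixed by the residue of `W`. -/
theorem eq_coPath_of_path {f : ℕ → ℕ} {n : ℕ} (h0 : f 0 = 0)
    (hf : ∀ k < n, A.CoD (f k) (f (k + 1))) :
    ∃ a, 1 ≤ a ∧ a < A.W ∧ ∀ k ≤ n, f k = A.coPath a k := by
  have hW := two_le_W (A := A)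
  have hstem : ∀ k ≤ n, k < A.W → f k = 0 * A.W + k := by
    intro k
    induction k with
    | zero => intro _ _; simpa using h0
    | succ k ih =>
      intro hk hkW
      have h := hf k (by omega)
      rw [ih (by omega) (by omega)] at h
      have h' := h
      obtain ⟨a, -, b, -, a', -, b', -, ⟨⟨ha, hb⟩, ha', hb'⟩, ⟨-, hz⟩, -⟩ := h
      rw [hz, coD_code (by omega) (by omega) ha' hb'] at h'
      rcases h' with ⟨-, rfl, rfl⟩ | ⟨-, h1, -⟩ | ⟨h1, -⟩
      · exact hz
      · omega
      · omega
  rcases Nat.lt_or_ge n A.W with hn | hn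
  -- A path that stays on the stem makes no choice, so any admissible cycle length serves.
  · exact ⟨1, le_rfl, by omega, fun k hk => by
      rw [coPath_of_lt (by omega), hstem k hk (by omega)]⟩
  have h := hf (A.W - 1) (by omega)
  rw [hstem (A.W - 1) (by omega) (by omega), Nat.sub_add_cancel (by omega)] at h
  have h' := h
  obtain ⟨-, -, -, -, a, -, b, -, ⟨-, ha, hb⟩, ⟨-, hz⟩, -⟩ := h
  rw [hz, coD_code (by omega) (by omega) ha hb] at h'
  have hab : b < a ∧ A.W ≡ b [MOD a] := by
    rcases h' with ⟨-, -, h⟩ | ⟨-, -, h1, h2⟩ | ⟨h1, -⟩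
    · omega
    · exact ⟨h1, h2⟩
    · omega
  have ha1 : 1 ≤ a := by omega
  refine ⟨a, ha1, ha, fun k hk => ?_⟩
  rcases Nat.lt_or_ge k A.W with hkW | hkW
  · rw [coPath_of_lt hkW, hstem k hk hkW]
  obtain ⟨l, rfl⟩ := Nat.exists_eq_add_of_le hkW
  rw [coPath_of_le hkW]
  clear hkW
  induction l with
  | zero =>
    rw [add_zero, hz, Nat.ModEq] at *
    rw [hab.2, Nat.mod_eq_of_lt hab.1]
  | succ l ih =>
    have h := hf (A.W + l) (by omega)
    rw [ih (by omega)] at h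
    have hlt := Nat.mod_lt (A.W + l) ha1
    have h' := h
    obtain ⟨-, -, -, -, a', -, b', -, ⟨-, ha', hb'⟩, ⟨-, hz'⟩, -⟩ := h
    rw [hz', coD_code ha (by omega) ha' hb'] at h'
    rw [← add_assoc, hz']
    rcases h' with ⟨h1, -⟩ | ⟨h1, -⟩ | ⟨-, rfl, h1, h2⟩
    · omega
    · omega
    · have := mod_add_one_cases ha1 (A.W + l)
      have hlt' := Nat.mod_lt (A.W + l + 1) ha1
      omega

/-- On the stem rejection is recorded directly. From `W ≥ 2 * m` on, the analysis by leaves applies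
and exactly one cycle length is correct, which gives both the language and unambiguity. -/
theorem Unamb.coF_coPath (hA : A.Unamb) {a n : ℕ} (ha : 1 ≤ a) (haW : a < A.W) :
    A.CoF (A.coPath a n) ↔ ¬A.Acc n ∧ (A.W ≤ n → a = A.path A.m n) := by
  have hlt := Nat.mod_lt n ha
  rcases Nat.lt_or_ge n A.W with h | h
  · rw [coPath_of_lt h, coF_code (by omega) h]
    constructor
    · rintro (⟨-, h1⟩ | h1)
      · exact ⟨h1, fun h2 => by omega⟩
      · have := h1.1
        omega
    · exact fun h1 => Or.inl ⟨rfl, h1.1⟩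
  · have hm : 2 * A.m ≤ n := le_trans (by unfold W; omega) h
    rw [coPath_of_le h, coF_code haW (by omega)]
    constructor
    · rintro (⟨h1, -⟩ | h1)
      · omega
      · exact ⟨hA.not_acc_of_leaf hm h1, fun _ => hA.eq_of_leaf h1⟩
    · rintro ⟨h1, h2⟩
      rw [h2 h]
      exact Or.inr (hA.leaf_of_not_acc hm h1)

theorem compl_run_eq {w : List Unit} {r : Fin (w.length + 1) → Fin A.X}
    (hr : A.compl.IsAcceptingRun w r) :
    ∃ a, 1 ≤ a ∧ a < A.W ∧ ∀ i, (r i : ℕ) = A.coPath a i := by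
  obtain ⟨a, h1, h2, h3⟩ := eq_coPath_of_path (A := A)
    (f := fun k => if h : k < w.length + 1 then (r ⟨k, h⟩ : ℕ) else 0) (n := w.length)
    (by
      have h : (r 0 : ℕ) = 0 := hr.1
      simpa using h)
    (fun k hk => by
      have h : A.CoD (r ⟨k, by omega⟩) (r ⟨k + 1, by omega⟩) := hr.2.1 ⟨k, hk⟩
      have : k < w.length + 1 := by omega
      simpa [hk, this] using h)
  refine ⟨a, h1, h2, fun i => ?_⟩
  have := h3 i (by omega)
  rwa [dif_pos i.2] at this

theorem Unamb.exists_compl_run_iff (hA : A.Unamb) (w : List Unit) :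
    (∃ r, A.compl.IsAcceptingRun w r) ↔ ¬A.Acc w.length := by
  constructor
  · rintro ⟨r, hr⟩
    obtain ⟨a, h1, h2, h3⟩ := compl_run_eq hr
    have h := hr.2.2
    change A.CoF _ at h
    rw [h3, Fin.val_last, hA.coF_coPath h1 h2] at h
    exact h.1
  · intro h
    obtain ⟨p1, -, -⟩ := hA.path_invariant A.m w.length
    have p2 : A.path A.m w.length < A.W := by
      have := hA.path_le A.m w.length
      unfold W
      omega
    set a := A.path A.m w.length with ha
    have hlt : ∀ k, A.coPath a k < A.X := fun k => by
      rcases Nat.lt_or_ge k A.W with h | h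
      · rw [coPath_of_lt h]
        exact code_lt (by omega) h
      · rw [coPath_of_le h]
        exact code_lt p2 ((Nat.mod_lt _ p1).trans p2)
    refine ⟨fun i => ⟨A.coPath a i, hlt i⟩, ?_, fun i => coD_coPath p1 p2, ?_⟩
    · show A.coPath a 0 = 0
      rw [coPath_of_lt (by have := two_le_W (A := A); omega)]
      simp
    · show A.CoF (A.coPath a w.length)
      rw [hA.coF_coPath p1 p2]
      exact ⟨h, fun _ => ha⟩

theorem Unamb.compl_isUnambiguous (hA : A.Unamb) : A.compl.IsUnambiguous := by
  refine ⟨fun w hw => ?_, fun w hw r hr =>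
    hw ((A.compl.mem_accepts_iff_exists_run w).2 ⟨r, hr⟩)⟩
  obtain ⟨r, hr⟩ := (A.compl.mem_accepts_iff_exists_run w).1 hw
  refine ⟨r, hr, fun r' hr' => ?_⟩
  obtain ⟨a, h1, h2, h3⟩ := compl_run_eq hr
  obtain ⟨a', h1', h2', h3'⟩ := compl_run_eq hr'
  have h : A.CoF _ := hr.2.2
  rw [h3, Fin.val_last, hA.coF_coPath h1 h2] at h
  have h' : A.CoF _ := hr'.2.2
  rw [h3', Fin.val_last, hA.coF_coPath h1' h2'] at h'
  ext i
  rw [h3, h3']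
  rcases Nat.lt_or_ge w.length A.W with hw | hw
  · rw [coPath_of_lt (by omega), coPath_of_lt (by omega)]
  · rw [h.2 hw, h'.2 hw]

theorem compl_accepts (hM : M.IsUnambiguous) : (ofNFA M).compl.accepts = M.acceptsᶜ := by
  ext w
  rw [NFA.mem_accepts_iff_exists_run, (unamb_ofNFA hM).exists_compl_run_iff,
    ← mem_accepts_iff_acc]
  rfl

end UnaryAut

/-! ### Reading the automaton and its tables from memory -/

namespace RAM

open UnaryAut

/-- The unary automaton described by a memory. -/
def aut (s : Memory) : UnaryAut where
  m := s.reg 0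
  D i j := i < s.reg 0 ∧ j < s.reg 0 ∧ s.arr 0 (i * s.reg 0 + j) ≠ 0
  I i := i < s.reg 0 ∧ s.arr 1 i ≠ 0
  F i := i < s.reg 0 ∧ s.arr 2 i ≠ 0
  lt_of_D _ _ h := ⟨h.1, h.2.1⟩
  lt_of_I _ h := h.1
  lt_of_F _ h := h.1

/-- The program is analysed for the automaton read off an arbitrary initial memory; this links it to
the given one. -/
theorem aut_eq_ofNFA {s : Memory} {m : ℕ} {M : NFA Unit (Fin m)} (h : Holds s M) :
    aut s = ofNFA M := by
  obtain ⟨rfl, hD, hI, hF⟩ := h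
  have eD : (aut s).D = (ofNFA M).D := by
    funext i j
    refine propext ⟨fun ⟨hi, hj, h⟩ => ?_, ?_⟩
    · rw [hD ⟨i, hi⟩ ⟨j, hj⟩] at h
      exact ⟨⟨i, hi⟩, ⟨j, hj⟩, rfl, rfl, by simpa using h⟩
    · rintro ⟨i, j, rfl, rfl, h⟩
      exact ⟨i.2, j.2, by rw [hD i j]; simpa using h⟩
  have eI : (aut s).I = (ofNFA M).I := by
    funext i
    refine propext ⟨fun ⟨hi, h⟩ => ?_, ?_⟩
    · rw [hI ⟨i, hi⟩] at h
      exact ⟨⟨i, hi⟩, rfl, by simpa using h⟩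
    · rintro ⟨i, rfl, h⟩
      exact ⟨i.2, by rw [hI i]; simpa using h⟩
  have eF : (aut s).F = (ofNFA M).F := by
    funext i
    refine propext ⟨fun ⟨hi, h⟩ => ?_, ?_⟩
    · rw [hF ⟨i, hi⟩] at h
      exact ⟨⟨i, hi⟩, rfl, by simpa using h⟩
    · rintro ⟨i, rfl, h⟩
      exact ⟨i.2, by rw [hF i]; simpa using h⟩
  have em : (aut s).m = (ofNFA M).m := rfl
  generalize aut s = U at *
  generalize ofNFA M = V at *
  cases U
  cases V
  simp only at eD eI eF em
  subst eD eI eF em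
  rfl

section Knowledge

variable {γ α : Type} [Locals α] {B : Base γ} {π : γ → Memory} {f h k : γ → α → ℕ} {n : γ → ℕ}

/-- The registers `0`, `1`, `2` hold the sizes for the automaton described by `π g`. -/
structure Knows (B : Base γ) (π : γ → Memory) : Prop where
  X_eq : ∀ g, B.X g = (aut (π g)).X
  m_eq : ∀ g r A, B.E g r A → r 0 = (aut (π g)).m
  W_eq : ∀ g r A, B.E g r A → r 2 = (aut (π g)).W

/-- The first rows of the table `G` are in array `b`. -/
def HasRows (B : Base γ) (π : γ → Memory) (b : ℕ) (G : Memory → ℕ → ℕ → ℕ) (n : γ → ℕ) : Prop :=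
  ∀ g r A, B.E g r A → Rows (aut (π g)).X (n g) (G (π g)) (A b)

/-- Array `b` is as in the initial memory. -/
def HasRaw (B : Base γ) (π : γ → Memory) (b : ℕ) : Prop :=
  ∀ g r A, B.E g r A → A b = (π g).arr b

theorem Knows.restrict (hB : Knows B π) (c : γ → Prop) : Knows (B.restrict c) π :=
  ⟨hB.X_eq, fun g r A h => hB.m_eq g r A h.1, fun g r A h => hB.W_eq g r A h.1⟩

theorem HasRaw.restrict {b : ℕ} (hB : HasRaw B π b) (c : γ → Prop) :
    HasRaw (B.restrict c) π b := fun g r A h => hB g r A h.1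

theorem HasRows.restrict {b : ℕ} {G : Memory → ℕ → ℕ → ℕ} (hB : HasRows B π b G n) (c : γ → Prop) :
    HasRows (B.restrict c) π b G n := fun g r A h => hB g r A h.1

theorem Knows.m (hB : Knows B π) : Comp B fun g (_ : α) => (aut (π g)).m :=
  Comp.move 0 (by omega) fun g _ s hE _ => hB.m_eq g _ _ hE

theorem Knows.W (hB : Knows B π) : Comp B fun g (_ : α) => (aut (π g)).W :=
  Comp.move 2 (by omega) fun g _ s hE _ => hB.W_eq g _ _ hE

theorem Knows.ex (hB : Knows B π) {p : γ → α → ℕ → Prop}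
    (hp : CompP B fun g (q : α × ℕ) => p g q.1 q.2) :
    CompP B fun g q => ∃ v < (aut (π g)).X, p g q v :=
  hp.ex.congr fun g _ _ _ => by rw [hB.X_eq g]

theorem Knows.all (hB : Knows B π) {p : γ → α → ℕ → Prop}
    (hp : CompP B fun g (q : α × ℕ) => p g q.1 q.2) :
    CompP B fun g q => ∀ v < (aut (π g)).X, p g q v :=
  hp.all.congr fun g _ _ _ => by rw [hB.X_eq g]

theorem HasRows.comp (hB : Knows B π) {b : ℕ} {G : Memory → ℕ → ℕ → ℕ} (hG : HasRows B π b G n)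
    (hf : Comp B f) (hh : Comp B h)
    (hfn : ∀ g q, B.Valid g → Locals.Bdd q (B.X g) → f g q < n g ∧ f g q < B.X g)
    (hhX : ∀ g q, B.Valid g → Locals.Bdd q (B.X g) → h g q < B.X g) :
    Comp B fun g q => G (π g) (f g q) (h g q) :=
  Comp.load b ((hf.mul Comp.bound fun g q hg hq => (hfn g q hg hq).2.le).add hh)
    fun g q r A hE hq => by
      have h1 := hhX g q ⟨r, A, hE⟩ hq
      rw [hB.X_eq g] at h1 ⊢
      exact hG g r A hE _ (hfn g q ⟨r, A, hE⟩ hq).1 _ h1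

theorem Knows.comp_I (hB : Knows B π) (hA : HasRaw B π 1) (hf : Comp B f) :
    CompP B fun g q => (aut (π g)).I (f g q) :=
  (CompP.lt hf hB.m).and (CompP.ne_zero <| Comp.load 1 hf (h := fun g q => (π g).arr 1 (f g q))
    fun g q r A hE _ => by rw [hA g r A hE])

theorem Knows.comp_F (hB : Knows B π) (hA : HasRaw B π 2) (hf : Comp B f) :
    CompP B fun g q => (aut (π g)).F (f g q) :=
  (CompP.lt hf hB.m).and (CompP.ne_zero <| Comp.load 2 hf (h := fun g q => (π g).arr 2 (f g q))
    fun g q r A hE _ => by rw [hA g r A hE])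

theorem Knows.comp_D (hB : Knows B π) (hA : HasRaw B π 0) (hf : Comp B f) (hh : Comp B h)
    (hX : ∀ g q, B.Valid g → Locals.Bdd q (B.X g) → f g q < B.X g) :
    CompP B fun g q => (aut (π g)).D (f g q) (h g q) :=
  (CompP.lt hf hB.m).and ((CompP.lt hh hB.m).and
    (CompP.ne_zero <| Comp.load 0 ((hf.mul hB.m fun g q hg hq => (hX g q hg hq).le).add hh)
      (h := fun g q => (π g).arr 0 (f g q * (π g).reg 0 + h g q))
      fun g q r A hE _ => by rw [hA g r A hE]; rfl))

/-- Row `t` of this table lists which pairs of states are joined by a path of length `t`. -/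
noncomputable def rchTable (s : Memory) (t c : ℕ) : ℕ :=
  ind (∃ i < (aut s).X, ∃ j < (aut s).X, (i < (aut s).m ∧ j < (aut s).m) ∧
    c = i * (aut s).m + j ∧ (aut s).Rch t i j)

theorem mul_m_add_lt {A : UnaryAut} {i j : ℕ} (hi : i < A.m) (hj : j < A.m) :
    i * A.m + j < A.X := by
  have h1 : (i + 1) * A.m ≤ A.m * A.m := Nat.mul_le_mul_right _ hi
  have h2 : A.m ≤ A.W := by unfold UnaryAut.W; omega
  have h3 : A.m * A.m ≤ A.X := Nat.mul_le_mul h2 h2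
  rw [add_mul] at h1
  omega

theorem rchTable_pos_iff {s : Memory} {t i j : ℕ} (hi : i < (aut s).m) (hj : j < (aut s).m) :
    0 < rchTable s t (i * (aut s).m + j) ↔ (aut s).Rch t i j := by
  rw [rchTable, ind_pos]
  constructor
  · rintro ⟨i', -, j', -, ⟨hi', hj'⟩, h, hr⟩
    have h2 := congrArg (· % (aut s).m) h
    simp only [Nat.mul_add_mod', Nat.mod_eq_of_lt hj, Nat.mod_eq_of_lt hj'] at h2
    subst h2
    have h3 : i * (aut s).m = i' * (aut s).m := by omega
    rwa [Nat.eq_of_mul_eq_mul_right (by omega) h3]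
  · exact fun hr => ⟨i, hi.trans m_lt_X, j, hj.trans m_lt_X, ⟨hi, hj⟩, rfl, hr⟩

theorem Knows.comp_Rch (hB : Knows B π) (hR : HasRows B π 4 rchTable n)
    (hf : Comp B f) (hh : Comp B h) (hk : Comp B k)
    (hfn : ∀ g q, B.Valid g → Locals.Bdd q (B.X g) → f g q < n g ∧ f g q < B.X g)
    (hhX : ∀ g q, B.Valid g → Locals.Bdd q (B.X g) → h g q < B.X g) :
    CompP B fun g q => (aut (π g)).Rch (f g q) (h g q) (k g q) := by
  have hidx : Comp B fun g q => h g q * (aut (π g)).m + k g q :=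
    (hh.mul hB.m fun g q hg hq => (hhX g q hg hq).le).add hk
  -- Conjunctions are evaluated without short-circuit, so the column is clamped to stay inside the
  -- row even if `h` or `k` is not a state; the range tests then make the value read irrelevant.
  have hmin : Comp B fun g q => min (h g q * (aut (π g)).m + k g q) (B.X g - 1) :=
    (hidx.sub (hidx.sub (Comp.bound.sub (.const 1)))).congr fun g q _ _ => by omega
  refine ((CompP.lt hh hB.m).and ((CompP.lt hk hB.m).and
    (CompP.lt (.const 0) (HasRows.comp hB hR hf hmin hfn fun g q hg hq => ?_)))).congr
    fun g q hg hq => ?_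
  · have := hhX g q hg hq
    omega
  · constructor
    · rintro ⟨h1, h2, h3⟩
      rwa [min_eq_left, rchTable_pos_iff h1 h2] at h3
      have := mul_m_add_lt h1 h2
      rw [hB.X_eq]
      omega
    · intro hr
      obtain ⟨h1, h2⟩ := hr.lt
      refine ⟨h1, h2, ?_⟩
      rw [min_eq_left, rchTable_pos_iff h1 h2]
      · exact hr
      · have := mul_m_add_lt h1 h2
        rw [hB.X_eq]
        omega

/-- Congruence is a search for the quotient of the difference; since both sides are below `X`, so is
the quotient, and for modulus `0` the quotient `0` serves. -/
theorem CompP.modEq (hf : Comp B f) (hh : Comp B h) (hk : Comp B k)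
    (hfX : ∀ g q, B.Valid g → Locals.Bdd q (B.X g) → f g q < B.X g)
    (hhX : ∀ g q, B.Valid g → Locals.Bdd q (B.X g) → h g q < B.X g) :
    CompP B fun g q => f g q ≡ h g q [MOD k g q] := by
  have hm : Comp B fun g (q : α × ℕ) => q.2 * k g q.1 :=
    Comp.var.mul hk.weak fun _ _ _ hq => hq.2.le
  refine (CompP.ex (p := fun g q v => f g q = h g q + v * k g q ∨ h g q = f g q + v * k g q)
    ((CompP.eq hf.weak (hh.weak.add hm)).or (CompP.eq hh.weak (hf.weak.add hm)))).congr
    fun g q hg hq => ?_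
  have h1 := hfX g q hg hq
  have h2 := hhX g q hg hq
  constructor
  · rintro ⟨v, -, h | h⟩ <;> rw [h]
    · exact Nat.add_mul_mod_self_right _ _ _
    · exact (Nat.add_mul_mod_self_right _ _ _).symm
  · intro hmod
    have key : ∀ a b, a ≤ b → b < B.X g → a ≡ b [MOD k g q] →
        ∃ v < B.X g, b = a + v * k g q := by
      intro a b hab hb hm
      obtain ⟨c, hc⟩ := (Nat.modEq_iff_dvd' hab).1 hm
      rcases Nat.eq_zero_or_pos (k g q) with h0 | h0
      · rw [h0] at hc ⊢
        exact ⟨0, by omega, by omega⟩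
      · refine ⟨c, ?_, by rw [mul_comm]; omega⟩
        have : c ≤ k g q * c := Nat.le_mul_of_pos_left _ h0
        omega
    rcases le_total (f g q) (h g q) with hle | hle
    · obtain ⟨v, hv, h⟩ := key _ _ hle h2 hmod
      exact ⟨v, hv, Or.inr h⟩
    · obtain ⟨v, hv, h⟩ := key _ _ hle h1 hmod.symm
      exact ⟨v, hv, Or.inl h⟩

theorem CompP.dvd (hf : Comp B f) (hh : Comp B h)
    (hhX : ∀ g q, B.Valid g → Locals.Bdd q (B.X g) → h g q < B.X g) :
    CompP B fun g q => f g q ∣ h g q := by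
  refine (CompP.ex (p := fun g q v => h g q = v * f g q)
    (CompP.eq hh.weak (Comp.var.mul hf.weak fun _ _ _ hq => hq.2.le))).congr
    fun g q hg hq => ?_
  have h1 := hhX g q hg hq
  constructor
  · rintro ⟨v, -, h⟩
    exact ⟨v, by rw [h, mul_comm]⟩
  · rintro ⟨v, hv⟩
    rcases Nat.eq_zero_or_pos (f g q) with h0 | h0
    · exact ⟨0, by omega, by rw [hv, h0]; simp⟩
    · refine ⟨v, ?_, by rw [hv, mul_comm]⟩
      have : v ≤ f g q * v := Nat.le_mul_of_pos_left _ h0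
      omega

end Knowledge

end RAM

/-! ### Deciding periods, leaves and the complement automaton -/

namespace RAM

open UnaryAut

section Predicates

variable {γ α : Type} [Locals α] {B : Base γ} {π : γ → Memory} {f h k l : γ → α → ℕ}

theorem Knows.m_lt (hB : Knows B π) (g : γ) : (aut (π g)).m < B.X g := by
  rw [hB.X_eq]
  exact m_lt_X

theorem Knows.comp_Init (hB : Knows B π) (h1 : HasRaw B π 1)
    (hR : HasRows B π 4 rchTable fun g => (aut (π g)).X) (hf : Comp B f) (hh : Comp B h)
    (hfX : ∀ g q, B.Valid g → Locals.Bdd q (B.X g) → f g q < B.X g) :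
    CompP B fun g q => (aut (π g)).Init (f g q) (h g q) := by
  refine (hB.ex (p := fun g q i => (aut (π g)).I i ∧ (aut (π g)).Rch (f g q) i (h g q))
    ((hB.comp_I h1 Comp.var).and (hB.comp_Rch hR hf.weak Comp.var hh.weak (fun g q hg hq => ?_)
    fun _ _ _ hq => hq.2))).congr fun g q _ _ => ?_
  · have := hfX g q.1 hg hq.1
    rw [← hB.X_eq]
    exact ⟨this, this⟩
  · exact ⟨fun ⟨i, _, h⟩ => ⟨i, h⟩, fun ⟨i, h⟩ => ⟨i, h.2.lt.1.trans m_lt_X, h⟩⟩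

theorem Knows.comp_Final (hB : Knows B π) (h2 : HasRaw B π 2)
    (hR : HasRows B π 4 rchTable fun g => (aut (π g)).X) (hf : Comp B f) (hh : Comp B h)
    (hfX : ∀ g q, B.Valid g → Locals.Bdd q (B.X g) → f g q < B.X g)
    (hhX : ∀ g q, B.Valid g → Locals.Bdd q (B.X g) → h g q < B.X g) :
    CompP B fun g q => (aut (π g)).Final (f g q) (h g q) := by
  refine (hB.ex (p := fun g q j => (aut (π g)).Rch (f g q) (h g q) j ∧ (aut (π g)).F j)
    ((hB.comp_Rch hR hf.weak hh.weak Comp.var (fun g q hg hq => ?_)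
    fun g q hg hq => hhX g q.1 hg hq.1).and (hB.comp_F h2 Comp.var))).congr fun g q _ _ => ?_
  · have := hfX g q.1 hg hq.1
    rw [← hB.X_eq]
    exact ⟨this, this⟩
  · exact ⟨fun ⟨i, _, h⟩ => ⟨i, h⟩, fun ⟨i, h⟩ => ⟨i, h.1.lt.2.trans m_lt_X, h⟩⟩

theorem Knows.comp_S_of_Rch (hB : Knows B π) (h1 : HasRaw B π 1) (h2 : HasRaw B π 2)
    (hR : HasRows B π 4 rchTable fun g => (aut (π g)).X) (hf : Comp B f) (hh : Comp B h)
    (hfX : ∀ g q, B.Valid g → Locals.Bdd q (B.X g) → f g q < B.X g)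
    (hhX : ∀ g q, B.Valid g → Locals.Bdd q (B.X g) → h g q < B.X g) :
    CompP B fun g q => (aut (π g)).S (f g q) (h g q) := by
  have hPer : CompP B fun g (q : α × ℕ) => 1 ≤ f g q.1 ∧
      (aut (π g)).Rch (f g q.1) q.2 q.2 ∧ ∀ p < (aut (π g)).X, p < f g q.1 → 1 ≤ p →
        ¬(aut (π g)).Rch p q.2 q.2 := by
    refine (CompP.le (.const 1) hf.weak).and ((hB.comp_Rch hR hf.weak Comp.var Comp.var
      (fun g q hg hq => ?_) fun _ _ _ hq => hq.2).and (hB.all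
        (p := fun g (q : α × ℕ) p => p < f g q.1 → 1 ≤ p → ¬(aut (π g)).Rch p q.2 q.2)
      ((CompP.lt Comp.var hf.weak.weak).imp ((CompP.le (.const 1) Comp.var).imp
      (CompP.not (hB.comp_Rch hR Comp.var Comp.var.weak Comp.var.weak (fun g q hg hq => ?_)
      fun _ _ _ hq => hq.1.2))))))
    · have := hfX g q.1 hg hq.1
      rw [← hB.X_eq]
      exact ⟨this, this⟩
    · rw [← hB.X_eq]
      exact ⟨hq.2, hq.2⟩
  refine ((CompP.le hf hB.m).and ((CompP.le hB.m hh).and (hB.ex (p := fun g q y =>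
    (aut (π g)).Init (aut (π g)).m y ∧ (1 ≤ f g q ∧ (aut (π g)).Rch (f g q) y y ∧
      ∀ p < (aut (π g)).X, p < f g q → 1 ≤ p → ¬(aut (π g)).Rch p y y) ∧
      (aut (π g)).Final (h g q - (aut (π g)).m) y)
    ((hB.comp_Init h1 hR hB.m Comp.var fun g _ _ _ => hB.m_lt g).and (hPer.and
      (hB.comp_Final h2 hR (hh.weak.sub hB.m) Comp.var (fun g q hg hq => ?_)
      fun _ _ _ hq => hq.2)))))).congr fun g q hg hq => ?_
  · have := hhX g q.1 hg hq.1
    omega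
  · constructor
    · rintro ⟨h1, h2, y, -, h3, ⟨h4, h5, h6⟩, h7⟩
      have := m_lt_X (A := aut (π g))
      exact ⟨h1, h2, y, h3, ⟨h4, h5, fun p' hp' h8 => h6 p' (by omega) hp' h8⟩, h7⟩
    · rintro ⟨h1, h2, y, h3, ⟨h4, h5, h6⟩, h7⟩
      exact ⟨h1, h2, y, h5.lt.1.trans m_lt_X, h3, ⟨h4, h5, fun p' _ hp' h8 => h6 p' hp' h8⟩, h7⟩

/-- The table of the lengths accepted with each period. -/
noncomputable def periodTable (s : Memory) (p x : ℕ) : ℕ := ind ((aut s).S p x)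

theorem Knows.comp_S (hB : Knows B π) (hS : HasRows B π 5 periodTable fun g => (aut (π g)).X)
    (hf : Comp B f) (hh : Comp B h)
    (hfX : ∀ g q, B.Valid g → Locals.Bdd q (B.X g) → f g q < B.X g)
    (hhX : ∀ g q, B.Valid g → Locals.Bdd q (B.X g) → h g q < B.X g) :
    CompP B fun g q => (aut (π g)).S (f g q) (h g q) :=
  HasRows.comp hB hS hf hh (fun g q hg hq => by
    have := hfX g q hg hq
    rw [← hB.X_eq]
    exact ⟨this, this⟩) hhX

theorem Knows.comp_Live (hB : Knows B π) (hS : HasRows B π 5 periodTable fun g => (aut (π g)).X)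
    (hf : Comp B f) (hh : Comp B h) (hk : Comp B k)
    (hhX : ∀ g q, B.Valid g → Locals.Bdd q (B.X g) → h g q < B.X g)
    (hkX : ∀ g q, B.Valid g → Locals.Bdd q (B.X g) → k g q < B.X g) :
    CompP B fun g q => (aut (π g)).Live (f g q) (h g q) (k g q) :=
  (hB.ex (p := fun g q y => (aut (π g)).m + (aut (π g)).m ≤ y ∧ y ≡ h g q [MOD f g q] ∧
      (aut (π g)).S (k g q) y)
    ((CompP.le (hB.m.add hB.m) Comp.var).and ((CompP.modEq Comp.var hh.weak hf.weak
      (fun _ _ _ hq => hq.2) fun g q hg hq => hhX g q.1 hg hq.1).and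
      (hB.comp_S hS hk.weak Comp.var (fun g q hg hq => hkX g q.1 hg hq.1)
      fun _ _ _ hq => hq.2)))).congr fun g q _ _ => by
        simp only [Live, two_mul]

theorem Knows.comp_exists_Live (hB : Knows B π)
    (hS : HasRows B π 5 periodTable fun g => (aut (π g)).X) (hf : Comp B f) (hh : Comp B h)
    (hhX : ∀ g q, B.Valid g → Locals.Bdd q (B.X g) → h g q < B.X g) :
    CompP B fun g q => ∃ p < (aut (π g)).X, (aut (π g)).Live (f g q) (h g q) p :=
  hB.ex (p := fun g q p => (aut (π g)).Live (f g q) (h g q) p)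
    (hB.comp_Live hS hf.weak hh.weak Comp.var (fun g q hg hq => hhX g q.1 hg hq.1)
      fun _ _ _ hq => hq.2)

theorem Knows.comp_Refines (hB : Knows B π)
    (hS : HasRows B π 5 periodTable fun g => (aut (π g)).X)
    (hf : Comp B f) (hh : Comp B h) (hk : Comp B k)
    (hhX : ∀ g q, B.Valid g → Locals.Bdd q (B.X g) → h g q < B.X g)
    (hkX : ∀ g q, B.Valid g → Locals.Bdd q (B.X g) → k g q < B.X g) :
    CompP B fun g q => (aut (π g)).Refines (f g q) (h g q) (k g q) :=
  (CompP.le (.const 1) hk).and ((CompP.dvd hf hk hkX).and ((hB.comp_exists_Live hS hf hh hhX).imp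
    (hB.ex (p := fun g q p => (aut (π g)).Live (f g q) (h g q) p ∧ p ∣ k g q)
      ((hB.comp_Live hS hf.weak hh.weak Comp.var (fun g q hg hq => hhX g q.1 hg hq.1)
      fun _ _ _ hq => hq.2).and (CompP.dvd Comp.var hk.weak
        fun g q hg hq => hkX g q.1 hg hq.1)))))

/-- The table of the moduli in the iterated refinement. -/
noncomputable def pathTable (s : Memory) (k x : ℕ) : ℕ := (aut s).path k x

theorem Knows.comp_Leaf (hB : Knows B π) (hS : HasRows B π 5 periodTable fun g => (aut (π g)).X)
    (hP : HasRows B π 6 pathTable fun g => (aut (π g)).X) (hf : Comp B f) (hh : Comp B h)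
    (hhX : ∀ g q, B.Valid g → Locals.Bdd q (B.X g) → h g q < B.X g) :
    CompP B fun g q => (aut (π g)).Leaf (f g q) (h g q) :=
  (CompP.lt hh hf).and ((CompP.eq (HasRows.comp hB hP hB.m hh
    (fun g _ _ _ => ⟨m_lt_X, hB.m_lt g⟩) hhX) hf).and
    (hB.comp_exists_Live hS hf hh hhX).not)

theorem Knows.comp_Acc (hB : Knows B π) (h1 : HasRaw B π 1) (h2 : HasRaw B π 2)
    (hR : HasRows B π 4 rchTable fun g => (aut (π g)).X) (hf : Comp B f)
    (hfX : ∀ g q, B.Valid g → Locals.Bdd q (B.X g) → f g q < B.X g) :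
    CompP B fun g q => (aut (π g)).Acc (f g q) :=
  (hB.ex (p := fun g q i => (aut (π g)).I i ∧ (aut (π g)).Final (f g q) i)
    ((hB.comp_I h1 Comp.var).and (hB.comp_Final h2 hR hf.weak Comp.var
      (fun g q hg hq => hfX g q.1 hg hq.1) fun _ _ _ hq => hq.2))).congr fun g _ _ _ =>
    ⟨fun ⟨i, _, hi, j, h⟩ => ⟨i, j, hi, h⟩,
      fun ⟨i, j, hi, h⟩ => ⟨i, ((aut (π g)).lt_of_I i hi).trans m_lt_X, hi, j, h⟩⟩

theorem Knows.comp_CoF (hB : Knows B π) (h1 : HasRaw B π 1) (h2 : HasRaw B π 2)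
    (hR : HasRows B π 4 rchTable fun g => (aut (π g)).X)
    (hS : HasRows B π 5 periodTable fun g => (aut (π g)).X)
    (hP : HasRows B π 6 pathTable fun g => (aut (π g)).X) (hf : Comp B f) :
    CompP B fun g q => (aut (π g)).CoF (f g q) :=
  hB.ex (p := fun g q a => ∃ b < (aut (π g)).X, (a < (aut (π g)).W ∧ b < (aut (π g)).W) ∧
      f g q = a * (aut (π g)).W + b ∧ ((a = 0 ∧ ¬(aut (π g)).Acc b) ∨ (aut (π g)).Leaf a b))
    (hB.ex (p := fun g (q : α × ℕ) b => (q.2 < (aut (π g)).W ∧ b < (aut (π g)).W) ∧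
      f g q.1 = q.2 * (aut (π g)).W + b ∧
        ((q.2 = 0 ∧ ¬(aut (π g)).Acc b) ∨ (aut (π g)).Leaf q.2 b))
      (((CompP.lt Comp.var.weak hB.W).and (CompP.lt Comp.var hB.W)).and
        ((CompP.eq hf.weak.weak ((Comp.var.weak.mul hB.W fun _ _ _ hq => hq.1.2.le).add
          Comp.var)).and (((CompP.eq Comp.var.weak (.const 0)).and
          (hB.comp_Acc h1 h2 hR Comp.var fun _ _ _ hq => hq.2).not).or
          (hB.comp_Leaf hS hP Comp.var.weak Comp.var fun _ _ _ hq => hq.2)))))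

theorem Knows.comp_CoStep (hB : Knows B π) (hf : Comp B f) (hh : Comp B h) (hk : Comp B k)
    (hl : Comp B l) (hlX : ∀ g q, B.Valid g → Locals.Bdd q (B.X g) → l g q < B.X g) :
    CompP B fun g q => (aut (π g)).CoStep (f g q) (h g q) (k g q) (l g q) := by
  have hW : ∀ g, (aut (π g)).W < B.X g := fun g => by
    rw [hB.X_eq]
    have h2 := two_le_W (A := aut (π g))
    have : (aut (π g)).W * 2 ≤ (aut (π g)).X := Nat.mul_le_mul_left _ h2
    omega
  exact ((CompP.eq hf (.const 0)).and ((CompP.eq hk (.const 0)).and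
      (CompP.eq hl (hh.add (.const 1))))).or
    (((CompP.eq hf (.const 0)).and ((CompP.eq (hh.add (.const 1)) hB.W).and
      ((CompP.lt hl hk).and (CompP.modEq hB.W hl hk (fun g _ _ _ => hW g) hlX)))).or
    ((CompP.lt hh hf).and ((CompP.eq hk hf).and ((CompP.lt hl hf).and
      ((CompP.eq hl (hh.add (.const 1))).or ((CompP.eq (hh.add (.const 1)) hf).and
        (CompP.eq hl (.const 0))))))))

theorem Knows.comp_CoD (hB : Knows B π) (hf : Comp B f) (hh : Comp B h) :
    CompP B fun g q => (aut (π g)).CoD (f g q) (h g q) :=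
  hB.ex (p := fun g q a => ∃ b < (aut (π g)).X, ∃ a' < (aut (π g)).X, ∃ b' < (aut (π g)).X,
      ((a < (aut (π g)).W ∧ b < (aut (π g)).W) ∧ (a' < (aut (π g)).W ∧ b' < (aut (π g)).W)) ∧
      (f g q = a * (aut (π g)).W + b ∧ h g q = a' * (aut (π g)).W + b') ∧
      (aut (π g)).CoStep a b a' b')
    (hB.ex (p := fun g (q : α × ℕ) b => ∃ a' < (aut (π g)).X, ∃ b' < (aut (π g)).X,
      ((q.2 < (aut (π g)).W ∧ b < (aut (π g)).W) ∧ (a' < (aut (π g)).W ∧ b' < (aut (π g)).W)) ∧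
      (f g q.1 = q.2 * (aut (π g)).W + b ∧ h g q.1 = a' * (aut (π g)).W + b') ∧
      (aut (π g)).CoStep q.2 b a' b')
    (hB.ex (p := fun g (q : (α × ℕ) × ℕ) a' => ∃ b' < (aut (π g)).X,
      ((q.1.2 < (aut (π g)).W ∧ q.2 < (aut (π g)).W) ∧
        (a' < (aut (π g)).W ∧ b' < (aut (π g)).W)) ∧
      (f g q.1.1 = q.1.2 * (aut (π g)).W + q.2 ∧ h g q.1.1 = a' * (aut (π g)).W + b') ∧
      (aut (π g)).CoStep q.1.2 q.2 a' b')
    (hB.ex (p := fun g (q : ((α × ℕ) × ℕ) × ℕ) b' =>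
      ((q.1.1.2 < (aut (π g)).W ∧ q.1.2 < (aut (π g)).W) ∧
        (q.2 < (aut (π g)).W ∧ b' < (aut (π g)).W)) ∧
      (f g q.1.1.1 = q.1.1.2 * (aut (π g)).W + q.1.2 ∧
        h g q.1.1.1 = q.2 * (aut (π g)).W + b') ∧
      (aut (π g)).CoStep q.1.1.2 q.1.2 q.2 b')
    ((((CompP.lt Comp.var.weak.weak.weak hB.W).and (CompP.lt Comp.var.weak.weak hB.W)).and
      ((CompP.lt Comp.var.weak hB.W).and (CompP.lt Comp.var hB.W))).and
    (((CompP.eq hf.weak.weak.weak.weak ((Comp.var.weak.weak.weak.mul hB.W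
        fun _ _ _ hq => hq.1.1.1.2.le).add Comp.var.weak.weak)).and
      (CompP.eq hh.weak.weak.weak.weak ((Comp.var.weak.mul hB.W
        fun _ _ _ hq => hq.1.2.le).add Comp.var))).and
      (hB.comp_CoStep Comp.var.weak.weak.weak Comp.var.weak.weak Comp.var.weak Comp.var
        fun _ _ _ hq => hq.2))))))

end Predicates

end RAM

namespace RAM

open UnaryAut

/-! ### The complementation program -/

/-- The contents of the input arrays. -/
def Raw (s : Memory) (A : ℕ → ℕ → ℕ) : Prop := ∀ b < 3, A b = s.arr b

/-- The table of the values of `halvingProd`. -/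
def halvingTable (_ : Memory) (i _ : ℕ) : ℕ := halvingProd i

theorem row_index {γ α : Type} [Locals α] {m X w : γ → ℕ} {T : γ → (ℕ → ℕ → ℕ) → Prop} {b : ℕ}
    {G : γ → ℕ → ℕ → ℕ} : Comp (row m X w T b G) fun g (_ : α) => g.2 :=
  Comp.move 3 (by omega) fun _ _ _ hE _ => hE.2.2.2.2.1

theorem m_add_one_le_X (A : UnaryAut) : A.m + 1 ≤ A.X := m_lt_X

/-- The loop bound is `m + 1` at this stage, as `X` is defined through `halvingProd m`. Row `i`
depends only on row `i / 2`, read in column `0`; all columns are equal. -/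
theorem run_halvingTable : Run (fun s => (aut s).X)
    (tab (fun s => (aut s).m) (fun s => (aut s).m + 1) (fun _ => 0) Raw)
    (tab (fun s => (aut s).m) (fun s => (aut s).m + 1) (fun _ => 0) fun s A => Raw s A ∧
      Rows ((aut s).m + 1) ((aut s).m + 1) (halvingTable s) (A 3)) := by
  refine Run.fill 3 halvingTable (fun s _ => m_add_one_le_X _)
    (fun s A A' h hT b hb => (h b (by omega)).trans (hT b hb)) ?_ fun s A h h' => ⟨h, h'⟩
  set B := row (fun s => (aut s).m) (fun s => (aut s).m + 1) (fun _ => 0) Raw 3 halvingTable with hB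
  -- Half of `i`, rounded down, is the least `v` with `i ≤ 2 * v + 1`.
  have hhalf : Comp B fun g (_ : Unit × ℕ) => g.2 / 2 :=
    (Comp.least (p := fun g _ v => g.2 ≤ v + v + 1) (CompP.le row_index
      ((Comp.var.add Comp.var).add (.const 1)))).congr fun g q hg _ => by
      obtain ⟨r, A, hE⟩ := hg
      have h : g.2 < B.X g := hE.2.2.2.2.2.1
      exact least_eq (by omega) (by omega) fun u hu => by omega
  refine Comp.select_ghost (c := fun g => g.2 = 0) (CompP.eq row_index (.const 0)) (.const 1)
    (h := fun g _ => g.2 * halvingProd (g.2 / 2)) (Comp.mul (f := fun g _ => g.2) (row_index.restrict _)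
      (Comp.load 3 ((hhalf.restrict _).mul Comp.bound ?_) ?_) ?_)
    (fun g q hg => ?_) (fun g q hg => ?_)
  · rintro g q ⟨r, A, hE, hg⟩ -
    have h : g.2 < B.X g := hE.2.2.2.2.2.1
    show g.2 / 2 ≤ B.X g
    omega
  · rintro g q r A ⟨hE, hg⟩ -
    have h := hE.2.2.2.2.2.2 (g.2 / 2) (by omega) 0 (Nat.succ_pos _)
    exact h
  · rintro g q ⟨r, A, hE, hg⟩ -
    exact hE.2.2.2.2.2.1.le
  · simp [halvingTable, hg, halvingProd_zero]
  · exact halvingProd_of_pos (by omega)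

/-- A product needs its first factor within the current loop bound, so register `1` is raised in
stages `0`, `m + 1`, `W`, `W * W`; every stage is bounded by `X`, as the time estimate requires. -/
theorem run_sizes : Run (fun s => (aut s).X)
    (tab (fun s => (aut s).m) (fun _ => 0) (fun _ => 0) Raw)
    (tab (fun s => (aut s).m) (fun s => (aut s).X) (fun s => (aut s).W) Raw) := by
  refine Run.trans (B' := tab (fun s => (aut s).m) (fun s => (aut s).m + 1) (fun _ => 0) Raw)
    (Run.assign 1 (f := fun s _ => (aut s).m + 1)
      (Comp.add (Comp.move 0 (by omega) fun _ _ _ hE _ => hE.1) (.const 1))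
      (fun _ _ => Nat.zero_le _)
      fun s r A hE => ⟨by simpa using hE.1, by simp, by simpa using hE.2.2.1, hE.2.2.2⟩) ?_
  refine run_halvingTable.trans ?_
  refine Run.trans (B' := tab (fun s => (aut s).m) (fun s => (aut s).m + 1) (fun s => (aut s).W) Raw)
    (Run.assign 2 (f := fun s _ => (aut s).W) ?_ (fun _ _ => m_add_one_le_X _)
      fun s r A hE => ⟨by simpa using hE.1, by simpa using hE.2.1, by simp, hE.2.2.2.1⟩) ?_
  · have hm : Comp (α := Unit) (tab (fun s => (aut s).m) (fun s => (aut s).m + 1) (fun _ => 0)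
        fun s A => Raw s A ∧ Rows ((aut s).m + 1) ((aut s).m + 1) (halvingTable s) (A 3))
        fun s _ => (aut s).m := Comp.move 0 (by omega) fun _ _ _ hE _ => hE.1
    refine (Comp.add (Comp.add (Comp.load (h := fun s _ => halvingProd (aut s).m) 3
      (hm.mul Comp.bound fun s _ _ _ => Nat.le_succ _) fun s _ r A hE _ => ?_) (hm.add hm))
      (.const 2)).congr fun s _ _ _ => by simp only [UnaryAut.W, two_mul]
    exact hE.2.2.2.2 (aut s).m (Nat.lt_succ_self _) 0 (Nat.succ_pos _)
  refine Run.trans (B' := tab (fun s => (aut s).m) (fun s => (aut s).W) (fun s => (aut s).W) Raw)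
    (Run.assign 1 (f := fun s _ => (aut s).W) (Comp.move 2 (by omega) fun _ _ _ hE _ => hE.2.2.1)
      (fun _ _ => m_add_one_le_X _)
      fun s r A hE => ⟨by simpa using hE.1, by simp, by simpa using hE.2.2.1, hE.2.2.2⟩) ?_
  exact Run.assign 1 (f := fun s _ => (aut s).X) (Comp.mul Comp.bound Comp.bound
      fun _ _ _ _ => le_rfl) (fun _ _ => W_le_X)
      fun s r A hE => ⟨by simpa using hE.1, by simp, by simpa using hE.2.2.1, hE.2.2.2⟩

/-- Memories with all sizes computed and arrays satisfying `T`. -/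
abbrev sized (T : Memory → (ℕ → ℕ → ℕ) → Prop) : Base Memory :=
  tab (fun s => (aut s).m) (fun s => (aut s).X) (fun s => (aut s).W) T

/-- The same while the rows of a table are being filled. -/
abbrev sizedRow (T : Memory → (ℕ → ℕ → ℕ) → Prop) (b : ℕ) (G : Memory → ℕ → ℕ → ℕ) :
    Base (Memory × ℕ) :=
  row (fun s => (aut s).m) (fun s => (aut s).X) (fun s => (aut s).W) T b G

/-- The whole table `G` is stored in array `b`. -/
def Table (b : ℕ) (G : Memory → ℕ → ℕ → ℕ) (s : Memory) (A : ℕ → ℕ → ℕ) : Prop :=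
  Rows (aut s).X (aut s).X (G s) (A b)

/-! ### Filling the tables -/

section Fill

variable {T : Memory → (ℕ → ℕ → ℕ) → Prop} {b : ℕ} {G : Memory → ℕ → ℕ → ℕ}

theorem knows_sizedRow : Knows (sizedRow T b G) Prod.fst :=
  ⟨fun _ => rfl, fun _ _ _ h => h.1, fun _ _ _ h => h.2.2.1⟩

theorem hasRaw_sizedRow {a : ℕ} (ha : a < 3) (hT : ∀ s A, T s A → Raw s A) :
    HasRaw (sizedRow T b G) Prod.fst a := fun _ _ _ h => hT _ _ h.2.2.2.1 a ha

theorem hasRows_sizedRow {a : ℕ} {H : Memory → ℕ → ℕ → ℕ} (hT : ∀ s A, T s A → Table a H s A) :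
    HasRows (sizedRow T b G) Prod.fst a H fun g => (aut g.1).X :=
  fun _ _ _ h => hT _ _ h.2.2.2.1

theorem hasRows_sizedRow_self : HasRows (sizedRow T b G) Prod.fst b G fun g => g.2 :=
  fun _ _ _ h => h.2.2.2.2.2.2

theorem row_index_lt {g : Memory × ℕ} (h : (sizedRow T b G).Valid g) :
    g.2 < (sizedRow T b G).X g := by
  obtain ⟨r, A, h⟩ := h
  exact h.2.2.2.2.2.1

theorem Table.of_eq {a : ℕ} {s : Memory} {A A' : ℕ → ℕ → ℕ} (h : A' a = A a)
    (hT : Table a G s A) : Table a G s A' := by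
  rwa [Table, h]

theorem Raw.of_eq {s : Memory} {A A' : ℕ → ℕ → ℕ} (h : ∀ a < 3, A' a = A a)
    (hT : Raw s A) : Raw s A' := fun a ha => (h a ha).trans (hT a ha)

theorem run_fill (hT : ∀ g A A', (∀ a, a ≠ b → A' a = A a) → T g A → T g A')
    (hG : Comp (sizedRow T b G) fun g (q : Unit × ℕ) => G g.1 g.2 q.2) :
    Run (fun s => (aut s).X) (sized T) (sized fun s A => T s A ∧ Table b G s A) :=
  Run.fill b G (fun _ _ => le_rfl) hT hG fun _ _ h h' => ⟨h, h'⟩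

end Fill

theorem run_rchTable : Run (fun s => (aut s).X) (sized Raw)
    (sized fun s A => Raw s A ∧ Table 4 rchTable s A) := by
  refine run_fill (fun s A A' h => Raw.of_eq fun a ha => h a (by omega)) ?_
  have hB : Knows (sizedRow Raw 4 rchTable) Prod.fst := knows_sizedRow
  have h0 : HasRaw (sizedRow Raw 4 rchTable) Prod.fst 0 :=
    hasRaw_sizedRow (by omega) fun _ _ h => h
  have hR := hasRows_sizedRow_self (T := Raw) (b := 4) (G := rchTable)
  -- Decoding a column as a pair `i * m + j` is common to row `0` and to the later rows, which
  -- differ only in the condition `p` on the pair.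
  have key : ∀ (c : Memory × ℕ → Prop) (p : Memory × ℕ → ((Unit × ℕ) × ℕ) × ℕ → Prop),
      CompP ((sizedRow Raw 4 rchTable).restrict c) p →
      CompP ((sizedRow Raw 4 rchTable).restrict c) fun g (q : Unit × ℕ) =>
        ∃ i < (aut g.1).X, ∃ j < (aut g.1).X, (i < (aut g.1).m ∧ j < (aut g.1).m) ∧
          q.2 = i * (aut g.1).m + j ∧ p g ((q, i), j) := fun c p hp =>
    (hB.restrict c).ex (p := fun g q i => ∃ j < (aut g.1).X,
        (i < (aut g.1).m ∧ j < (aut g.1).m) ∧ q.2 = i * (aut g.1).m + j ∧ p g ((q, i), j))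
      ((hB.restrict c).ex (p := fun g (q : (Unit × ℕ) × ℕ) j =>
          (q.2 < (aut g.1).m ∧ j < (aut g.1).m) ∧ q.1.2 = q.2 * (aut g.1).m + j ∧ p g (q, j))
        (((CompP.lt Comp.var.weak (hB.restrict c).m).and (CompP.lt Comp.var (hB.restrict c).m)).and
          ((CompP.eq Comp.var.weak.weak ((Comp.var.weak.mul (hB.restrict c).m
            fun _ _ _ hq => hq.1.2.le).add Comp.var)).and hp)))
  refine Comp.select_ghost (c := fun g => g.2 = 0) (CompP.eq row_index (.const 0))
    (key _ (fun _ q => q.1.2 = q.2) (CompP.eq Comp.var.weak Comp.var))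
    (key _ (fun g q => ∃ k < (aut g.1).X, (aut g.1).Rch (g.2 - 1) q.1.2 k ∧ (aut g.1).D k q.2)
      ((hB.restrict _).ex (p := fun g (q : ((Unit × ℕ) × ℕ) × ℕ) k =>
        (aut g.1).Rch (g.2 - 1) q.1.2 k ∧ (aut g.1).D k q.2)
      (((hB.restrict _).comp_Rch (hR.restrict _) ((row_index.restrict _).sub (.const 1))
        Comp.var.weak.weak Comp.var (fun g q hg _ => ?_) fun _ _ _ hq => hq.1.1.2).and
        ((hB.restrict _).comp_D (h0.restrict _) Comp.var Comp.var.weak fun _ _ _ hq => hq.2))))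
    (fun g q hg => ?_) fun g q hg => ?_
  · obtain ⟨r, A, hE, hg⟩ := hg
    have h1 := row_index_lt ⟨r, A, hE⟩
    exact ⟨by omega, lt_of_le_of_lt (Nat.sub_le _ _) h1⟩
  · refine ind_congr ?_
    simp only [hg]
    refine exists_congr fun i => and_congr_right fun _ => exists_congr fun j =>
      and_congr_right fun _ => and_congr_right fun h => and_congr_right fun _ => ?_
    exact ⟨fun h' => h'.1, fun h' => ⟨h', h.1⟩⟩
  · refine ind_congr ?_
    obtain ⟨t, ht⟩ : ∃ t, g.2 = t + 1 := ⟨g.2 - 1, by omega⟩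
    simp only [ht, Nat.add_sub_cancel]
    refine exists_congr fun i => and_congr_right fun _ => exists_congr fun j =>
      and_congr_right fun _ => and_congr_right fun h => and_congr_right fun _ => ?_
    exact ⟨fun ⟨k, h1, h2⟩ => ⟨k, h1.lt.2.trans m_lt_X, h1, h2⟩, fun ⟨k, _, h1, h2⟩ => ⟨k, h1, h2⟩⟩

theorem run_periodTable : Run (fun s => (aut s).X)
    (sized fun s A => Raw s A ∧ Table 4 rchTable s A)
    (sized fun s A => (Raw s A ∧ Table 4 rchTable s A) ∧ Table 5 periodTable s A) :=
  run_fill (fun s A A' h hT => ⟨hT.1.of_eq fun a ha => h a (by omega), hT.2.of_eq (h 4 (by omega))⟩)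
    (knows_sizedRow.comp_S_of_Rch (hasRaw_sizedRow (by omega) fun _ _ h => h.1)
      (hasRaw_sizedRow (by omega) fun _ _ h => h.1) (hasRows_sizedRow fun _ _ h => h.2)
      row_index Comp.var (fun _ _ hg _ => row_index_lt hg) fun _ _ _ hq => hq.2)

theorem run_pathTable : Run (fun s => (aut s).X)
    (sized fun s A => (Raw s A ∧ Table 4 rchTable s A) ∧ Table 5 periodTable s A)
    (sized fun s A => ((Raw s A ∧ Table 4 rchTable s A) ∧ Table 5 periodTable s A) ∧
      Table 6 pathTable s A) := by
  refine run_fill (fun s A A' h hT => ⟨⟨hT.1.1.of_eq fun a ha => h a (by omega),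
    hT.1.2.of_eq (h 4 (by omega))⟩, hT.2.of_eq (h 5 (by omega))⟩) ?_
  set T : Memory → (ℕ → ℕ → ℕ) → Prop := fun s A =>
    (Raw s A ∧ Table 4 rchTable s A) ∧ Table 5 periodTable s A with hT
  set B := sizedRow T 6 pathTable with hBdef
  have hB : Knows B Prod.fst := knows_sizedRow
  have hS : HasRows B Prod.fst 5 periodTable fun g => (aut g.1).X :=
    hasRows_sizedRow fun _ _ h => h.2
  have hP : HasRows B Prod.fst 6 pathTable fun g => g.2 := hasRows_sizedRow_self
  have hprev : Comp (B.restrict fun g => ¬g.2 = 0) fun g (q : Unit × ℕ) =>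
      pathTable g.1 (g.2 - 1) q.2 :=
    HasRows.comp (hB.restrict _) (hP.restrict _) ((row_index.restrict _).sub (.const 1)) Comp.var
      (fun g q hg _ => by
        obtain ⟨r, A, hE, hg⟩ := hg
        have h1 : g.2 < B.X g := row_index_lt ⟨r, A, hE⟩
        exact ⟨by omega, lt_of_le_of_lt (Nat.sub_le _ _) h1⟩) fun _ _ _ hq => hq.2
  refine Comp.select_ghost (c := fun g => g.2 = 0) (CompP.eq row_index (.const 0)) (.const 1)
    (Comp.least (p := fun g (q : Unit × ℕ) v =>
      (aut g.1).Refines (pathTable g.1 (g.2 - 1) q.2) q.2 v)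
      ((hB.restrict _).comp_Refines (hS.restrict _) hprev.weak.weak Comp.var.weak.weak Comp.var
        (fun _ _ _ hq => hq.1.1.2) fun _ _ _ hq => hq.2))
    (fun g q hg => ?_) fun g q hg => ?_
  · simp [pathTable, hg, UnaryAut.path]
  · obtain ⟨t, ht⟩ : ∃ t, g.2 = t + 1 := ⟨g.2 - 1, by omega⟩
    simp only [ht, Nat.add_sub_cancel]
    rfl

/-- The first row of this table describes the accepting states of the complement. -/
noncomputable def acceptTable (s : Memory) (_ x : ℕ) : ℕ := ind ((aut s).CoF x)

/-- The first row of this table describes the initial states of the complement. -/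
noncomputable def startTable (_ : Memory) (_ x : ℕ) : ℕ := ind (x = 0)

/-- The transition matrix of the complement. -/
noncomputable def stepTable (s : Memory) (x y : ℕ) : ℕ := ind ((aut s).CoD x y)

theorem run_acceptTable : Run (fun s => (aut s).X)
    (sized fun s A => ((Raw s A ∧ Table 4 rchTable s A) ∧ Table 5 periodTable s A) ∧
      Table 6 pathTable s A)
    (sized fun s A => (((Raw s A ∧ Table 4 rchTable s A) ∧ Table 5 periodTable s A) ∧
      Table 6 pathTable s A) ∧ Table 7 acceptTable s A) :=
  run_fill (fun s A A' h hT => ⟨⟨⟨hT.1.1.1.of_eq fun a ha => h a (by omega),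
    hT.1.1.2.of_eq (h 4 (by omega))⟩, hT.1.2.of_eq (h 5 (by omega))⟩, hT.2.of_eq (h 6 (by omega))⟩)
    (knows_sizedRow.comp_CoF (hasRaw_sizedRow (by omega) fun _ _ h => h.1.1.1)
      (hasRaw_sizedRow (by omega) fun _ _ h => h.1.1.1) (hasRows_sizedRow fun _ _ h => h.1.1.2)
      (hasRows_sizedRow fun _ _ h => h.1.2) (hasRows_sizedRow fun _ _ h => h.2) Comp.var)

/-- Acceptance in the complement depends on the input, so it was tabulated in array `7` before
arrays `0`, `1`, `2` are overwritten. The initial states and transitions of the complement need only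
the sizes. -/
theorem run_output : Run (fun s => (aut s).X) (sized (Table 7 acceptTable))
    (tab (fun s => (aut s).X) (fun s => (aut s).X) (fun s => (aut s).W) fun s A =>
      (Table 2 acceptTable s A ∧ Table 1 startTable s A) ∧ Table 0 stepTable s A) := by
  refine Run.trans (run_fill (b := 2) (G := acceptTable)
    (fun s A A' h hT => hT.of_eq (h 7 (by omega))) ?_) ?_
  · exact HasRows.comp knows_sizedRow (hasRows_sizedRow fun _ _ h => h) row_index Comp.var
      (fun _ _ hg _ => ⟨row_index_lt hg, row_index_lt hg⟩) fun _ _ _ hq => hq.2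
  refine Run.trans (Run.of_imp (B' := sized (Table 2 acceptTable))
    fun _ _ _ h => ⟨h.1, h.2.1, h.2.2.1, h.2.2.2.2⟩) ?_
  refine Run.trans (run_fill (b := 1) (G := startTable)
    (fun s A A' h hT => hT.of_eq (h 2 (by omega))) (CompP.eq Comp.var (.const 0))) ?_
  refine Run.trans (run_fill (b := 0) (G := stepTable)
    (fun s A A' h hT => ⟨hT.1.of_eq (h 2 (by omega)), hT.2.of_eq (h 1 (by omega))⟩)
    (knows_sizedRow.comp_CoD row_index Comp.var)) ?_
  exact Run.assign 0 (f := fun s _ => (aut s).X) Comp.bound (fun _ _ => le_rfl)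
    fun s r A hE => ⟨by simp, by simpa using hE.2.1, by simpa using hE.2.2.1, hE.2.2.2⟩

theorem exists_program : ∃ (p : Program) (τ : ℕ → ℕ), Poly τ ∧
    ∀ (m : ℕ) (M : NFA Unit (Fin m)) (s : Memory), IsInput s M →
      ∃ t s', Exec p s t s' ∧ Holds s' (ofNFA M).compl ∧ t ≤ τ (ofNFA M).X := by
  obtain ⟨p, τ, hτ, H⟩ := (run_sizes.trans (run_rchTable.trans (run_periodTable.trans
    (run_pathTable.trans (run_acceptTable.trans (Run.of_imp
      (B' := sized (Table 7 acceptTable)) fun _ _ _ h => ⟨h.1, h.2.1, h.2.2.1, h.2.2.2.2⟩)))))).trans run_output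
  refine ⟨p, τ, hτ, fun m M s hs => ?_⟩
  obtain ⟨t, s', he, ⟨h0, -, -, ⟨h2, h1⟩, hD⟩, ht⟩ := H s s
    ⟨rfl, hs.2.1 1 (by omega), hs.2.1 2 (by omega), fun _ _ => rfl⟩
  have hM := aut_eq_ofNFA hs.1
  replace h0 : s'.reg 0 = (aut s).X := h0
  replace ht : t ≤ τ (aut s).X := ht
  rw [hM] at h0 ht
  rw [Table, hM] at h1 h2 hD
  refine ⟨t, s', he, ⟨h0, fun i j => ?_, fun i => ?_, fun i => ?_⟩, ht⟩
  · rw [hD i i.2 j j.2, stepTable, hM]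
    rfl
  · have h := h1 0 ((Nat.zero_le _).trans_lt i.2) i i.2
    rw [zero_mul, zero_add] at h
    rw [h]
    rfl
  · have h := h2 0 ((Nat.zero_le _).trans_lt i.2) i i.2
    rw [zero_mul, zero_add] at h
    rw [h, acceptTable, hM]
    rfl

end RAM

/-! ### Bounds -/

/-- With `L = log y`, the recursion amounts to `L + (L - 1) * L / 2 = L * (L + 1) / 2`. A real bound
`y` replaces `m` so that it can be halved exactly while `m / 2` is rounded down. -/
theorem halvingProd_le_rpow (m : ℕ) {y : ℝ} (hy : 1 ≤ y) (hm : (m : ℝ) ≤ y) :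
    (halvingProd m : ℝ) ≤ 2 ^ (Real.logb 2 y * (Real.logb 2 y + 1) / 2) := by
  induction m using Nat.strong_induction_on generalizing y with
  | _ m ih =>
    have hl : 0 ≤ Real.logb 2 y := Real.logb_nonneg one_lt_two hy
    have h1 : (1 : ℝ) ≤ 2 ^ (Real.logb 2 y * (Real.logb 2 y + 1) / 2) :=
      Real.one_le_rpow one_le_two (by positivity)
    rcases Nat.lt_or_ge m 2 with h | h
    · have : halvingProd m = 1 := by
        interval_cases m
        · exact halvingProd_zero
        · rw [halvingProd_of_pos le_rfl]
          simp [halvingProd_zero]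
      rw [this]
      exact_mod_cast h1
    · have h2 : (2 : ℝ) ≤ m := by exact_mod_cast h
      have hhalf : ((m / 2 : ℕ) : ℝ) ≤ y / 2 := Nat.cast_div_le.trans (by push_cast; linarith)
      have hrec := ih (m / 2) (by omega) (y := y / 2) (by linarith) hhalf
      rw [Real.logb_div (by linarith) two_ne_zero, Real.logb_self_eq_one one_lt_two] at hrec
      rw [halvingProd_of_pos (by omega), Nat.cast_mul]
      calc (m : ℝ) * halvingProd (m / 2)
          ≤ 2 ^ Real.logb 2 y * 2 ^ ((Real.logb 2 y - 1) * (Real.logb 2 y - 1 + 1) / 2) := by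
            gcongr
            rwa [Real.rpow_logb two_pos (by norm_num) (by linarith)]
        _ = _ := by
            rw [← Real.rpow_add two_pos]
            ring_nf

theorem one_le_logb_two {n : ℕ} (hn : 2 ≤ n) : 1 ≤ Real.logb 2 n := by
  rw [Real.le_logb_iff_rpow_le one_lt_two (by positivity), Real.rpow_one]
  exact_mod_cast hn

/-- Since `2 ^ (L * (L + 1) / 2) = n ^ ((L + 1) / 2)`, the summands of `W` add up to at most `4 * n
^ ((L + 1) / 2)`. With `4 ≤ n ^ 2`, squaring gives the exponent `(L + 1) + 4`. -/
theorem UnaryAut.X_le_rpow (A : UnaryAut) {n : ℕ} (hn : 2 ≤ n) (hm : A.m ≤ n) :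
    (A.X : ℝ) ≤ (n : ℝ) ^ (Real.logb 2 n + 5) := by
  have hn2 : (2 : ℝ) ≤ n := by exact_mod_cast hn
  have hmn : (A.m : ℝ) ≤ n := by exact_mod_cast hm
  have hL := one_le_logb_two hn
  set L := Real.logb 2 n with hLdef
  have hF : (halvingProd A.m : ℝ) ≤ (n : ℝ) ^ ((L + 1) / 2) := by
    refine (halvingProd_le_rpow A.m (by linarith) hmn).trans_eq ?_
    conv_rhs => rw [← Real.rpow_logb two_pos (by norm_num) (show (0 : ℝ) < n by linarith)]
    rw [← Real.rpow_mul two_pos.le, ← hLdef]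
    ring_nf
  have h1 : (n : ℝ) ≤ (n : ℝ) ^ ((L + 1) / 2) := by
    conv_lhs => rw [← Real.rpow_one (n : ℝ)]
    exact Real.rpow_le_rpow_of_exponent_le (by linarith) (by linarith)
  have h4 : (4 : ℝ) ≤ (n : ℝ) ^ (2 : ℝ) := by
    rw [Real.rpow_two]
    nlinarith
  have hW : (A.W : ℝ) ≤ (n : ℝ) ^ ((L + 1) / 2 + 2) := by
    rw [Real.rpow_add (by linarith)]
    unfold UnaryAut.W
    push_cast
    have := mul_le_mul_of_nonneg_left h4 (show 0 ≤ (n : ℝ) ^ ((L + 1) / 2) by linarith)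
    linarith
  unfold UnaryAut.X
  push_cast
  calc (A.W : ℝ) * A.W ≤ (n : ℝ) ^ ((L + 1) / 2 + 2) * (n : ℝ) ^ ((L + 1) / 2 + 2) := by gcongr
    _ = _ := by
      rw [← Real.rpow_add (by linarith)]
      ring_nf

theorem RAM.Poly.exists_rpow_bound {τ : ℕ → ℕ} (hτ : RAM.Poly τ) : ∃ K : ℝ, ∀ n X : ℕ, 2 ≤ n →
    1 ≤ X → (X : ℝ) ≤ (n : ℝ) ^ (Real.logb 2 n + 5) →
      (τ X : ℝ) ≤ (n : ℝ) ^ (K * Real.logb 2 n) := by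
  obtain ⟨c, e, h⟩ := hτ
  -- The bound obtained is `n ^ (c + (L + 6) * e)`, and `L ≥ 1` absorbs the constants into `(c + 7 *
  -- e) * L`.
  refine ⟨c + 7 * e, fun n X hn hX hXn => ?_⟩
  have hn2 : (2 : ℝ) ≤ n := by exact_mod_cast hn
  have hX1 : (1 : ℝ) ≤ X := by exact_mod_cast hX
  have hL := one_le_logb_two hn
  set L := Real.logb 2 n with hLdef
  have hc : (c : ℝ) ≤ (n : ℝ) ^ (c : ℝ) := by
    rw [Real.rpow_natCast]
    exact_mod_cast (Nat.lt_two_pow_self (n := c)).le.trans (Nat.pow_le_pow_left hn c)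
  have hX2 : (X : ℝ) + 1 ≤ (n : ℝ) ^ (L + 6) := by
    rw [show L + 6 = (L + 5) + 1 by ring, Real.rpow_add (by linarith), Real.rpow_one]
    nlinarith
  calc (τ X : ℝ) ≤ c * ((X : ℝ) + 1) ^ e := by exact_mod_cast h X
    _ ≤ (n : ℝ) ^ (c : ℝ) * ((n : ℝ) ^ (L + 6)) ^ e := by gcongr
    _ = (n : ℝ) ^ (c + (L + 6) * e) := by
      rw [← Real.rpow_natCast, ← Real.rpow_mul (by linarith), ← Real.rpow_add (by linarith)]
    _ ≤ _ := by
      refine Real.rpow_le_rpow_of_exponent_le (by linarith) ?_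
      have h1 : (0 : ℝ) ≤ c := Nat.cast_nonneg c
      have h2 : (0 : ℝ) ≤ e := Nat.cast_nonneg e
      nlinarith [mul_nonneg h1 (sub_nonneg.2 hL), mul_nonneg h2 (sub_nonneg.2 hL)]

theorem mainTheorem2 :
    ∃ (P : RAM.Program) (C K : ℝ), ∀ n : ℕ, 2 ≤ n → ∀ m : ℕ, m ≤ n →
      ∀ A : NFA Unit (Fin m), A.IsUnambiguous →
        ∃ (M : ℕ) (B : NFA Unit (Fin M)),
          B.IsUnambiguous ∧ B.accepts = A.acceptsᶜ ∧
          (M : ℝ) ≤ (n : ℝ) ^ (Real.logb 2 n + C) ∧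
          ∀ s : RAM.Memory, RAM.IsInput s A →
            ∃ (t : ℕ) (s' : RAM.Memory), RAM.Exec P s t s' ∧ RAM.Holds s' B ∧
              (t : ℝ) ≤ (n : ℝ) ^ (K * Real.logb 2 n) := by
  obtain ⟨p, τ, hτ, H⟩ := RAM.exists_program
  obtain ⟨K, hK⟩ := hτ.exists_rpow_bound
  refine ⟨p, 5, K, fun n hn m hm A hA => ?_⟩
  have hX := (UnaryAut.ofNFA A).X_le_rpow hn hm
  refine ⟨_, (UnaryAut.ofNFA A).compl, (UnaryAut.unamb_ofNFA hA).compl_isUnambiguous,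
    UnaryAut.compl_accepts hA, hX, fun s hs => ?_⟩
  obtain ⟨t, s', he, hs', ht⟩ := H m A s hs
  refine ⟨t, s', he, hs', le_trans (by exact_mod_cast ht) (hK n _ hn ?_ hX)⟩
  exact (Nat.succ_le_of_lt ((Nat.zero_le _).trans_lt UnaryAut.m_lt_X))
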